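/- Let $(M,g)$ be a $d$-dimensional Einstein spacetime, $d\ge 4$: a smooth manifold with a smooth Lorentzian metric of signature $(-,+,\dots,+)$ such that $R_{\mu\nu}=\Lambda g_{\mu\nu}$ for a constant $\Lambda$. Let $\ell$ be a smooth nowhere vanishing null vector field on $M$. A null frame containing $\ell$ consists of smooth vector fields $\ell=e_{(0)}$, $n=e_{(1)}$, $m_{(i)}=e_{(i)}$ ($i=2,\dots,d-1$) on an open subset of the domain of a coordinate chart, whose only non-vanishing scalar products are $\ell\cdot n=1$ and $m_{(i)}\cdot m_{(j)}=\delta_{ij}$. With respect to such a frame put, for the Levi-Civita connection $\nabla$, $$\kappa_i=m_{(i)}\cdot\nabla_\ell\ell,\quad \rho_{ij}=m_{(i)}\cdot\nabla_{m_{(j)}}\ell,\quad \tau_i=m_{(i)}\cdot\nabla_n\ell,\quad \tau'_i=m_{(i)}\cdot\nabla_\ell n,$$ and for a GHP scalar $T_i$ of spin $1$ and boost weight $b$ $$\text{þ}\,T_i=\ell(T_i)-b\,(n\cdot\nabla_\ell\ell)\,T_i+\sum_k (m_{(i)}\cdot\nabla_\ell m_{(k)})\,T_k .$$ Assume that $\ell$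 is a multiple WAND, i.e. the Weyl components $C_{0i0j}$, $C_{0ijk}$ and $C_{010i}$ vanish everywhere in every null frame containing $\ell$ (so the spacetime is algebraically special), that $\ell$ is geodesic, i.e. $\kappa_i=0$, and that $\det\rho\ne 0$ everywhere. (These conditions do not depend on the choice of null frame containing $\ell$.) Then: 1. In every null frame $(\ell,n,m_{(i)})$ containing $\ell$, put $z=-\rho^{-1}\tau$, regarded as a GHP scalar of spin $1$ and boost weight $-1$. Then $z$ is smooth, the null rotation about $\ell$ $$\ell\mapsto\ell,\qquad n\mapsto n+z_i m_{(i)}-\tfrac12 z^2\ell,\qquad m_{(i)}\mapsto m_{(i)}-z_i\ell$$ gives a null frame containing $\ell$ in which $\tau=0$ and $\tau'=0$, and $\text{þ}z=-\tau'$, where þ and $\tau'$ are those of the original frame. 2. Consequently the second null vector can be chosen such that $\tau=\tau'=0$: there is a smooth null vector field $n$ on $M$ with $\ell\cdot n=1$ such that every point of $M$ (in each coordinate chart around it) has a neighbourhood with a null frame containing $\ell$ and $n$, and $\tau=\tau'=0$ in every such frame. -/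

import Mathlib

open scoped Manifold ContDiff Matrix Topology

noncomputable section

namespace GHP

/-- The model space `ℝ^d` of a `d`-dimensional spacetime. -/
abbrev Model (d : ℕ) : Type := EuclideanSpace ℝ (Fin d)

/-- A smooth Lorentzian metric (signature `(-,+,…,+)`) on a `d`-dimensional smooth manifold. -/
structure LorentzMetric (d : ℕ) (M : Type*) [TopologicalSpace M] [ChartedSpace (Model d) M]
    [IsManifold (𝓡 d) ∞ M] where
  inner (p : M) : TangentSpace (𝓡 d) p →L[ℝ] TangentSpace (𝓡 d) p →L[ℝ] ℝ
  symm (p : M) (v w : TangentSpace (𝓡 d) p) : inner p v w = inner p w v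
  lorentzian (p : M) : ∃ b : Module.Basis (Fin d) ℝ (TangentSpace (𝓡 d) p), ∀ i j,
    inner p (b i) (b j) = if i = j then (if (i : ℕ) = 0 then -1 else 1) else 0
  contMDiff : ContMDiff (𝓡 d) ((𝓡 d).prod 𝓘(ℝ, Model d →L[ℝ] Model d →L[ℝ] ℝ)) ∞
    (fun p ↦ Bundle.TotalSpace.mk' (Model d →L[ℝ] Model d →L[ℝ] ℝ)
      (E := fun p : M ↦ TangentSpace (𝓡 d) p →L[ℝ] TangentSpace (𝓡 d) p →L[ℝ] ℝ) p (inner p))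

/-! ### Levi-Civita connection and curvature in coordinates

`G` is a metric on (an open subset of) `ℝ^d`, and `x` is a point there. -/

section Coordinates

variable {d : ℕ}

/-- A field of bilinear forms on `ℝ^d`. -/
abbrev Metric (d : ℕ) : Type := Model d → (Model d →L[ℝ] Model d →L[ℝ] ℝ)

/-- Christoffel symbols of the second kind, as a bilinear expression in `u` and `v`:
`g(Γ(u,v), w) = ½ ((∂_u g)(v,w) + (∂_v g)(u,w) - (∂_w g)(u,v))`. -/
def christoffel (G : Metric d) (x u v : Model d) : Model d :=
  (G x).inverse ((1 / 2 : ℝ) •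
    (fderiv ℝ G x u v + fderiv ℝ G x v u - ((fderiv ℝ G x).flip u).flip v))

/-- The Levi-Civita derivative `∇_v Y` of the vector field `Y` at `x`. -/
def covDeriv (G : Metric d) (Y : Model d → Model d) (x v : Model d) : Model d :=
  fderiv ℝ Y x v + christoffel G x v (Y x)

/-- The Riemann curvature operator `R(u,v)w = ∇_u ∇_v w - ∇_v ∇_u w - ∇_[u,v] w`. -/
def curvature (G : Metric d) (x u v w : Model d) : Model d :=
  fderiv ℝ (fun y ↦ christoffel G y v w) x u - fderiv ℝ (fun y ↦ christoffel G y u w) x v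
    + christoffel G x u (christoffel G x v w) - christoffel G x v (christoffel G x u w)

/-- The Riemann tensor `R_{abcd} u^a v^b w^c z^d`, with
`(∇_a ∇_b - ∇_b ∇_a) V_c = R_{abcd} V^d`. -/
def riemann (G : Metric d) (x u v w z : Model d) : ℝ :=
  G x (curvature G x u v z) w

/-- The coordinate vector `∂_μ`. -/
def coordVec (μ : Fin d) : Model d := EuclideanSpace.single μ (1 : ℝ)

/-- The Ricci tensor `R_{bd} = R^a_{bad}`. -/
def ricci (G : Metric d) (x v w : Model d) : ℝ :=
  ∑ μ : Fin d, (curvature G x (coordVec μ) v w) μ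

/-- The components `g^{μν}` of the inverse metric. -/
def inverseMetric (G : Metric d) (x : Model d) (μ ν : Fin d) : ℝ :=
  ((G x).inverse (EuclideanSpace.proj ν)) μ

/-- The scalar curvature `g^{μν} R_{μν}`. -/
def scalarCurvature (G : Metric d) (x : Model d) : ℝ :=
  ∑ μ : Fin d, ∑ ν : Fin d, inverseMetric G x μ ν * ricci G x (coordVec μ) (coordVec ν)

/-- The Weyl tensor `C_{abcd} u^a v^b w^c z^d`. -/
def weyl (G : Metric d) (x u v w z : Model d) : ℝ :=
  riemann G x u v w z
    - 1 / ((d : ℝ) - 2) * (G x u w * ricci G x v z - G x u z * ricci G x v w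
        - G x v w * ricci G x u z + G x v z * ricci G x u w)
    + scalarCurvature G x / (((d : ℝ) - 1) * ((d : ℝ) - 2))
        * (G x u w * G x v z - G x u z * G x v w)

/-! ### Null frames, spin coefficients, null rotations -/

/-- The vector fields `ℓ`, `n`, `m_i` of a frame; the spatial index takes `d - 2` values. -/
structure Frame (d : ℕ) where
  l : Model d → Model d
  n : Model d → Model d
  m : Fin (d - 2) → Model d → Model d

/-- `F` is a smooth null frame on `U` for the metric `G`: the only non-vanishing scalar products
are `ℓ·n = 1` and `m_i·m_j = δ_ij`. -/
structure IsNullFrame (G : Metric d) (U : Set (Model d)) (F : Frame d) : Prop where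
  smooth_l : ContDiffOn ℝ ∞ F.l U
  smooth_n : ContDiffOn ℝ ∞ F.n U
  smooth_m : ∀ i, ContDiffOn ℝ ∞ (F.m i) U
  ll : ∀ x ∈ U, G x (F.l x) (F.l x) = 0
  nn : ∀ x ∈ U, G x (F.n x) (F.n x) = 0
  ln : ∀ x ∈ U, G x (F.l x) (F.n x) = 1
  lm : ∀ x ∈ U, ∀ i, G x (F.l x) (F.m i x) = 0
  nm : ∀ x ∈ U, ∀ i, G x (F.n x) (F.m i x) = 0
  mm : ∀ x ∈ U, ∀ i j, G x (F.m i x) (F.m j x) = if i = j then 1 else 0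

namespace Frame

/-- `κ_i = L_{i0} = m_i · ∇_ℓ ℓ`. -/
def kappa (G : Metric d) (F : Frame d) (x : Model d) : Fin (d - 2) → ℝ :=
  fun i ↦ G x (F.m i x) (covDeriv G F.l x (F.l x))

/-- `ρ_ij = L_{ij} = m_i · ∇_{m_j} ℓ`. -/
def rho (G : Metric d) (F : Frame d) (x : Model d) : Matrix (Fin (d - 2)) (Fin (d - 2)) ℝ :=
  Matrix.of fun i j ↦ G x (F.m i x) (covDeriv G F.l x (F.m j x))

/-- `τ_i = L_{i1} = m_i · ∇_n ℓ`. -/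
def tau (G : Metric d) (F : Frame d) (x : Model d) : Fin (d - 2) → ℝ :=
  fun i ↦ G x (F.m i x) (covDeriv G F.l x (F.n x))

/-- `τ'_i = N_{i0} = m_i · ∇_ℓ n`. -/
def tau' (G : Metric d) (F : Frame d) (x : Model d) : Fin (d - 2) → ℝ :=
  fun i ↦ G x (F.m i x) (covDeriv G F.n x (F.l x))

/-- `L_{10} = n · ∇_ℓ ℓ`. -/
def L10 (G : Metric d) (F : Frame d) (x : Model d) : ℝ :=
  G x (F.n x) (covDeriv G F.l x (F.l x))

/-- The connection coefficients `M^k_{i0} = m_i · ∇_ℓ m_k`. -/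
def M0 (G : Metric d) (F : Frame d) (k i : Fin (d - 2)) (x : Model d) : ℝ :=
  G x (F.m i x) (covDeriv G (F.m k) x (F.l x))

/-- The GHP derivative `þ T_i = ℓ(T_i) - b L_{10} T_i + M^k_{i0} T_k` of a GHP scalar `T` of
spin 1 and boost weight `b`. -/
def thorn (G : Metric d) (F : Frame d) (b : ℤ) (T : Model d → Fin (d - 2) → ℝ) (x : Model d) :
    Fin (d - 2) → ℝ :=
  fun i ↦ fderiv ℝ (fun y ↦ T y i) x (F.l x) - b * F.L10 G x * T x i
    + ∑ k, F.M0 G k i x * T x k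

/-- The null rotation about `ℓ` with parameters `z_i`:
`ℓ ↦ ℓ`, `n ↦ n + z_i m_i - ½ z² ℓ`, `m_i ↦ m_i - z_i ℓ`. -/
def nullRotate (F : Frame d) (z : Model d → Fin (d - 2) → ℝ) : Frame d where
  l := F.l
  n := fun x ↦ F.n x + ∑ i, z x i • F.m i x - ((1 / 2 : ℝ) * ∑ i, z x i ^ 2) • F.l x
  m := fun i x ↦ F.m i x - z x i • F.l x

end Frame

end Coordinates

/-! ### Spacetimes -/

section Spacetime

variable {d : ℕ} {M : Type*} [TopologicalSpace M] [ChartedSpace (Model d) M]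
  [IsManifold (𝓡 d) ∞ M]

/-- The (smooth) coordinate charts of the manifold `M`. -/
def IsChart (φ : OpenPartialHomeomorph M (Model d)) : Prop :=
  φ ∈ IsManifold.maximalAtlas (𝓡 d) ∞ M

/-- The metric in the coordinates of the chart `φ`. -/
def metricInChart (g : LorentzMetric d M) (φ : OpenPartialHomeomorph M (Model d)) : Metric d :=
  fun y ↦
    let A : Model d →L[ℝ] Model d := mfderiv (𝓡 d) (𝓡 d) φ.symm y
    let B : Model d →L[ℝ] Model d →L[ℝ] ℝ := g.inner (φ.symm y)
    B.bilinearComp A A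

/-- A vector field in the coordinates of the chart `φ`. -/
def fieldInChart (φ : OpenPartialHomeomorph M (Model d))
    (X : (p : M) → TangentSpace (𝓡 d) p) : Model d → Model d :=
  fun y ↦ VectorField.mpullback (𝓡 d) (𝓡 d) φ.symm X y

/-- `X` is a smooth vector field on `M`. -/
def IsSmoothField (X : (p : M) → TangentSpace (𝓡 d) p) : Prop :=
  ContMDiff (𝓡 d) (𝓡 d).tangent ∞ fun p ↦ (⟨p, X p⟩ : TangentBundle (𝓡 d) M)

/-- `R_{μν} = Λ g_{μν}`. -/
def IsEinstein (g : LorentzMetric d M) (Λ : ℝ) : Prop :=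
  ∀ φ : OpenPartialHomeomorph M (Model d), IsChart φ → ∀ y ∈ φ.target, ∀ v w : Model d,
    ricci (metricInChart g φ) y v w = Λ * metricInChart g φ y v w

/-- `ℓ` is a (nowhere vanishing, smooth) null vector field. -/
structure IsNullField (g : LorentzMetric d M) (l : (p : M) → TangentSpace (𝓡 d) p) : Prop where
  smooth : IsSmoothField l
  ne_zero : ∀ p, l p ≠ 0
  null : ∀ p, g.inner p (l p) (l p) = 0

/-- `F` is a null frame containing `ℓ`, on an open subset `U` of the domain of coordinates `φ`. -/
structure IsFrameContaining (g : LorentzMetric d M) (l : (p : M) → TangentSpace (𝓡 d) p)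
    (φ : OpenPartialHomeomorph M (Model d)) (U : Set (Model d)) (F : Frame d) : Prop where
  isChart : IsChart φ
  isOpen : IsOpen U
  subset : U ⊆ φ.target
  isNullFrame : IsNullFrame (metricInChart g φ) U F
  l_eq : ∀ x ∈ U, F.l x = fieldInChart φ l x

/-- `ℓ` is a multiple WAND: it is null, and in every frame containing `ℓ` the Weyl components of
boost weight `+2` (`C_{0i0j}`) and `+1` (`C_{0ijk}`, `C_{010i}`) vanish everywhere. -/
structure IsMultipleWAND (g : LorentzMetric d M) (l : (p : M) → TangentSpace (𝓡 d) p) : Prop where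
  isNullField : IsNullField g l
  weyl_eq_zero : ∀ φ U F, IsFrameContaining g l φ U F → ∀ x ∈ U,
    (∀ i j, weyl (metricInChart g φ) x (F.l x) (F.m i x) (F.l x) (F.m j x) = 0) ∧
    (∀ i j k, weyl (metricInChart g φ) x (F.l x) (F.m i x) (F.m j x) (F.m k x) = 0) ∧
    (∀ i, weyl (metricInChart g φ) x (F.l x) (F.n x) (F.l x) (F.m i x) = 0)

/-- `ℓ` is geodesic: `κ_i = 0`. -/
def IsGeodesic (g : LorentzMetric d M) (l : (p : M) → TangentSpace (𝓡 d) p) : Prop :=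
  ∀ φ U F, IsFrameContaining g l φ U F → ∀ x ∈ U, F.kappa (metricInChart g φ) x = 0

/-- `det ρ ≠ 0` everywhere. -/
def HasNondegenerateRho (g : LorentzMetric d M) (l : (p : M) → TangentSpace (𝓡 d) p) : Prop :=
  ∀ φ U F, IsFrameContaining g l φ U F → ∀ x ∈ U, (F.rho (metricInChart g φ) x).det ≠ 0

/-- `F` is a null frame containing `ℓ` and `n`. -/
def IsFrameContainingPair (g : LorentzMetric d M) (l n : (p : M) → TangentSpace (𝓡 d) p)
    (φ : OpenPartialHomeomorph M (Model d)) (U : Set (Model d)) (F : Frame d) : Prop :=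
  IsFrameContaining g l φ U F ∧ ∀ x ∈ U, F.n x = fieldInChart φ n x

end Spacetime

end GHP

end

open GHP

noncomputable section

set_option maxSynthPendingDepth 3

namespace GHP

section LocalCalculus

variable {d : ℕ}

/-- `G` is a smooth nondegenerate symmetric metric on the open set `V`. -/
structure IsMetricOn (G : Metric d) (V : Set (Model d)) : Prop where
  isOpen : IsOpen V
  smooth : ContDiffOn ℝ ∞ G V
  symm : ∀ x ∈ V, ∀ v w, G x v w = G x w v
  nondeg : ∀ x ∈ V, ∀ v, (∀ w, G x v w = 0) → v = 0

namespace IsMetricOn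

variable {G : Metric d} {V : Set (Model d)} (hG : IsMetricOn G V) {x : Model d}
include hG

theorem mono {U : Set (Model d)} (hU : IsOpen U) (h : U ⊆ V) : IsMetricOn G U :=
  ⟨hU, hG.smooth.mono h, fun x hx ↦ hG.symm x (h hx), fun x hx ↦ hG.nondeg x (h hx)⟩

theorem contDiffAt (hx : x ∈ V) : ContDiffAt ℝ ∞ G x :=
  hG.smooth.contDiffAt (hG.isOpen.mem_nhds hx)

theorem differentiableAt (hx : x ∈ V) : DifferentiableAt ℝ G x :=
  (hG.contDiffAt hx).differentiableAt (by simp)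

theorem isInvertible (hx : x ∈ V) : (G x).IsInvertible := by
  have hinj : Function.Injective (G x) := by
    rw [injective_iff_map_eq_zero]
    intro v hv
    exact hG.nondeg x hx v fun w ↦ by simp [hv]
  have hfin : Module.finrank ℝ (Model d) = Module.finrank ℝ (Model d →L[ℝ] ℝ) := by
    rw [← Subspace.dual_finrank_eq (K := ℝ) (V := Model d)]
    exact (LinearMap.toContinuousLinearMap (𝕜 := ℝ) (E := Model d) (F' := ℝ)).finrank_eq
  refine ⟨(LinearEquiv.ofInjectiveOfFinrankEq (G x).toLinearMap hinj hfin).toContinuousLinearEquiv,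
    ?_⟩
  ext v w
  rfl

theorem apply_inverse (hx : x ∈ V) (f : Model d →L[ℝ] ℝ) : G x ((G x).inverse f) = f := by
  obtain ⟨e, he⟩ := hG.isInvertible hx
  rw [← he, ContinuousLinearMap.inverse_equiv]
  simp

theorem contDiffAt_inverse (hx : x ∈ V) : ContDiffAt ℝ ∞ (fun y ↦ (G y).inverse) x := by
  obtain ⟨e, he⟩ := hG.isInvertible hx
  have h := contDiffAt_map_inverse (𝕜 := ℝ) (n := ∞) e
  rw [he] at h
  exact h.comp x (hG.contDiffAt hx)

theorem fderiv_symm (hx : x ∈ V) (u v w : Model d) :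
    fderiv ℝ G x u v w = fderiv ℝ G x u w v := by
  have h : (fun y ↦ G y v w) =ᶠ[𝓝 x] fun y ↦ G y w v := by
    filter_upwards [hG.isOpen.mem_nhds hx] with y hy using hG.symm y hy v w
  have hd := hG.differentiableAt hx
  have key : ∀ a b : Model d, fderiv ℝ (fun y ↦ G y a b) x u = fderiv ℝ G x u a b := by
    intro a b
    have h1 := (hd.hasFDerivAt.clm_apply (hasFDerivAt_const a x)).clm_apply (hasFDerivAt_const b x)
    rw [h1.fderiv]
    simp
  rw [← key, ← key, h.fderiv_eq]

theorem apply_christoffel (hx : x ∈ V) (u v w : Model d) :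
    G x (christoffel G x u v) w
      = 1 / 2 * (fderiv ℝ G x u v w + fderiv ℝ G x v u w - fderiv ℝ G x w u v) := by
  rw [christoffel, hG.apply_inverse hx]
  simp

theorem ext (hx : x ∈ V) {v v' : Model d} (h : ∀ w, G x v w = G x v' w) : v = v' := by
  rw [← sub_eq_zero]
  refine hG.nondeg x hx _ fun w ↦ ?_
  simp [h w]

theorem christoffel_symm (hx : x ∈ V) (u v : Model d) :
    christoffel G x u v = christoffel G x v u := by
  refine hG.ext hx fun w ↦ ?_
  rw [hG.apply_christoffel hx, hG.apply_christoffel hx, hG.fderiv_symm hx w u v]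
  ring

end IsMetricOn

/-- The Christoffel symbols as a continuous bilinear map. -/
def christoffelL (G : Metric d) (x : Model d) : Model d →L[ℝ] Model d →L[ℝ] Model d :=
  (ContinuousLinearMap.compL ℝ (Model d) (Model d →L[ℝ] ℝ) (Model d) (G x).inverse).comp
    ((1 / 2 : ℝ) • (fderiv ℝ G x + (fderiv ℝ G x).flip
      - (ContinuousLinearMap.flipₗᵢ ℝ (Model d) (Model d) ℝ :
          (Model d →L[ℝ] Model d →L[ℝ] ℝ) →L[ℝ] (Model d →L[ℝ] Model d →L[ℝ] ℝ)).comp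
          (fderiv ℝ G x).flip))

@[simp]
theorem christoffelL_apply (G : Metric d) (x u v : Model d) :
    christoffelL G x u v = christoffel G x u v := rfl

theorem IsMetricOn.contDiffAt_christoffelL {G : Metric d} {V : Set (Model d)}
    (hG : IsMetricOn G V) {x : Model d} (hx : x ∈ V) : ContDiffAt ℝ ∞ (christoffelL G) x := by
  have h1 := hG.contDiffAt_inverse hx
  have h2 : ContDiffAt ℝ ∞ (fderiv ℝ G) x := (hG.contDiffAt hx).fderiv_right (by simp)
  have h3 : ContDiffAt ℝ ∞ (fun y ↦ (fderiv ℝ G y).flip) x :=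
    (ContinuousLinearMap.flipₗᵢ ℝ (Model d) (Model d)
      (Model d →L[ℝ] ℝ)).toContinuousLinearEquiv.contDiff.contDiffAt.comp x h2
  unfold christoffelL
  refine (contDiffAt_const.clm_apply h1).clm_comp ?_
  exact contDiffAt_const.smul (𝕜' := ℝ) ((h2.add h3).sub (contDiffAt_const.clm_comp h3))

theorem covDeriv_eq (G : Metric d) (Y : Model d → Model d) (x v : Model d) :
    covDeriv G Y x v = fderiv ℝ Y x v + christoffelL G x v (Y x) := rfl

theorem covDeriv_add (G : Metric d) (Y : Model d → Model d) (x v w : Model d) :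
    covDeriv G Y x (v + w) = covDeriv G Y x v + covDeriv G Y x w := by
  simp only [covDeriv_eq, map_add, add_apply]
  abel

theorem covDeriv_smul (G : Metric d) (Y : Model d → Model d) (x : Model d) (c : ℝ) (v : Model d) :
    covDeriv G Y x (c • v) = c • covDeriv G Y x v := by
  simp only [covDeriv_eq, map_smul, smul_apply, smul_add]

/-- The covariant derivative at `x` as a linear map in the direction. -/
def covDerivL (G : Metric d) (Y : Model d → Model d) (x : Model d) : Model d →ₗ[ℝ] Model d where
  toFun := covDeriv G Y x
  map_add' := covDeriv_add G Y x
  map_smul' := covDeriv_smul G Y x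

theorem covDeriv_sub (G : Metric d) (Y : Model d → Model d) (x v w : Model d) :
    covDeriv G Y x (v - w) = covDeriv G Y x v - covDeriv G Y x w :=
  map_sub (covDerivL G Y x) v w

theorem covDeriv_sum (G : Metric d) (Y : Model d → Model d) (x : Model d) {ι : Type*}
    (s : Finset ι) (v : ι → Model d) :
    covDeriv G Y x (∑ i ∈ s, v i) = ∑ i ∈ s, covDeriv G Y x (v i) :=
  map_sum (covDerivL G Y x) v s

theorem covDeriv_congr (G : Metric d) {Y Y' : Model d → Model d} {x : Model d}
    (h : Y =ᶠ[𝓝 x] Y') (v : Model d) : covDeriv G Y x v = covDeriv G Y' x v := by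
  rw [covDeriv_eq, covDeriv_eq, h.fderiv_eq, h.eq_of_nhds]

/-- Metric compatibility of the Levi-Civita connection. -/
theorem IsMetricOn.hasFDerivAt_inner {G : Metric d} {V : Set (Model d)} (hG : IsMetricOn G V)
    {x : Model d} (hx : x ∈ V) {Y Z : Model d → Model d} (hY : DifferentiableAt ℝ Y x)
    (hZ : DifferentiableAt ℝ Z x) (v : Model d) :
    fderiv ℝ (fun y ↦ G y (Y y) (Z y)) x v
      = G x (covDeriv G Y x v) (Z x) + G x (Y x) (covDeriv G Z x v) := by
  have h1 := ((hG.differentiableAt hx).hasFDerivAt.clm_apply hY.hasFDerivAt).clm_apply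
    hZ.hasFDerivAt
  rw [h1.fderiv]
  rw [covDeriv, covDeriv]
  simp only [map_add, add_apply]
  rw [hG.symm x hx (Y x) (christoffel G x v (Z x)), hG.apply_christoffel hx v (Y x), hG.apply_christoffel hx v (Z x),
    hG.fderiv_symm hx v (Z x) (Y x)]
  simp
  ring

theorem fderiv_covDeriv {G : Metric d} {V : Set (Model d)} (hG : IsMetricOn G V)
    {x : Model d} (hx : x ∈ V) {Y Z : Model d → Model d} (hY : DifferentiableAt ℝ Y x)
    (hZ : ContDiffAt ℝ ∞ Z x) (v : Model d) :
    fderiv ℝ (fun y ↦ covDeriv G Z y (Y y)) x v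
      = fderiv ℝ (fderiv ℝ Z) x v (Y x) + fderiv ℝ Z x (fderiv ℝ Y x v)
        + (fderiv ℝ (christoffelL G) x v (Y x) (Z x) + christoffel G x (fderiv ℝ Y x v) (Z x)
          + christoffel G x (Y x) (fderiv ℝ Z x v)) := by
  have h1 : DifferentiableAt ℝ (fderiv ℝ Z) x :=
    (hZ.fderiv_right (m := ∞) (by simp)).differentiableAt (by simp)
  have h2 : DifferentiableAt ℝ (christoffelL G) x :=
    (hG.contDiffAt_christoffelL hx).differentiableAt (by simp)
  have h3 : DifferentiableAt ℝ Z x := hZ.differentiableAt (by simp)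
  have h4 := (h1.hasFDerivAt.clm_apply hY.hasFDerivAt).add
    ((h2.hasFDerivAt.clm_apply hY.hasFDerivAt).clm_apply h3.hasFDerivAt)
  have h5 : (fun y ↦ covDeriv G Z y (Y y))
      = (fun y ↦ fderiv ℝ Z y (Y y)) + fun y ↦ christoffelL G y (Y y) (Z y) := rfl
  rw [h5, h4.fderiv]
  simp
  abel

theorem fderiv_christoffel {G : Metric d} {V : Set (Model d)} (hG : IsMetricOn G V)
    {x : Model d} (hx : x ∈ V) (u v w : Model d) :
    fderiv ℝ (fun y ↦ christoffel G y v w) x u = fderiv ℝ (christoffelL G) x u v w := by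
  have h2 : DifferentiableAt ℝ (christoffelL G) x :=
    (hG.contDiffAt_christoffelL hx).differentiableAt (by simp)
  have h := (h2.hasFDerivAt.clm_apply (hasFDerivAt_const v x)).clm_apply (hasFDerivAt_const w x)
  have h5 : (fun y ↦ christoffel G y v w) = fun y ↦ christoffelL G y v w := rfl
  rw [h5, h.fderiv]
  simp

/-- The Ricci identity, with `[X, Y] = ∇_X Y - ∇_Y X`. -/
theorem curvature_eq {G : Metric d} {V : Set (Model d)} (hG : IsMetricOn G V)
    {x : Model d} (hx : x ∈ V) {X Y Z : Model d → Model d} (hX : DifferentiableAt ℝ X x)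
    (hY : DifferentiableAt ℝ Y x) (hZ : ContDiffAt ℝ ∞ Z x) :
    curvature G x (X x) (Y x) (Z x)
      = covDeriv G (fun y ↦ covDeriv G Z y (Y y)) x (X x)
        - covDeriv G (fun y ↦ covDeriv G Z y (X y)) x (Y x)
        - covDeriv G Z x (covDeriv G Y x (X x) - covDeriv G X x (Y x)) := by
  have hs := hZ.isSymmSndFDerivAt (by
    rw [minSmoothness_of_isRCLikeNormedField]; exact WithTop.coe_le_coe.2 (le_top (a := (2 : ℕ∞))))
  have hs' := hs.eq (X x) (Y x)
  rw [covDeriv_sub, covDeriv_eq G (fun y ↦ covDeriv G Z y (Y y)), fderiv_covDeriv hG hx hY hZ,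
    covDeriv_eq G (fun y ↦ covDeriv G Z y (X y)), fderiv_covDeriv hG hx hX hZ, curvature, fderiv_christoffel hG hx, fderiv_christoffel hG hx, hs']
  simp only [covDeriv_eq, map_add, add_apply, christoffelL_apply]
  rw [hG.christoffel_symm hx (Y x) (X x)]
  abel

end LocalCalculus

section FrameAlgebra

variable {d : ℕ} {G : Metric d} {U : Set (Model d)} {F : Frame d} {x : Model d}

namespace IsNullFrame

theorem nl (hG : IsMetricOn G U) (hF : IsNullFrame G U F) (hx : x ∈ U) :
    G x (F.n x) (F.l x) = 1 := by rw [hG.symm x hx, hF.ln x hx]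

theorem ml (hG : IsMetricOn G U) (hF : IsNullFrame G U F) (hx : x ∈ U) (i : Fin (d - 2)) :
    G x (F.m i x) (F.l x) = 0 := by rw [hG.symm x hx, hF.lm x hx]

theorem mn (hG : IsMetricOn G U) (hF : IsNullFrame G U F) (hx : x ∈ U) (i : Fin (d - 2)) :
    G x (F.m i x) (F.n x) = 0 := by rw [hG.symm x hx, hF.nm x hx]

theorem sum_m_l (hG : IsMetricOn G U) (hF : IsNullFrame G U F) (hx : x ∈ U)
    (c : Fin (d - 2) → ℝ) : G x (∑ i, c i • F.m i x) (F.l x) = 0 := by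
  simp [map_sum, sum_apply, hF.ml hG hx]

theorem sum_m_n (hG : IsMetricOn G U) (hF : IsNullFrame G U F) (hx : x ∈ U)
    (c : Fin (d - 2) → ℝ) : G x (∑ i, c i • F.m i x) (F.n x) = 0 := by
  simp [map_sum, sum_apply, hF.mn hG hx]

theorem sum_m_m (hF : IsNullFrame G U F) (hx : x ∈ U)
    (c : Fin (d - 2) → ℝ) (j : Fin (d - 2)) : G x (∑ i, c i • F.m i x) (F.m j x) = c j := by
  simp [map_sum, sum_apply, hF.mm x hx]

/-- A vector is determined by its scalar products with the vectors of a null frame. -/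
theorem ext (hG : IsMetricOn G U) (hd : 2 ≤ d) (hF : IsNullFrame G U F) (hx : x ∈ U)
    {v w : Model d} (hl : G x v (F.l x) = G x w (F.l x)) (hn : G x v (F.n x) = G x w (F.n x))
    (hm : ∀ i, G x v (F.m i x) = G x w (F.m i x)) : v = w := by
  let T : Model d →ₗ[ℝ] ℝ × ℝ × (Fin (d - 2) → ℝ) :=
    { toFun := fun v ↦ (G x v (F.l x), G x v (F.n x), fun i ↦ G x v (F.m i x))
      map_add' := fun v w ↦ by ext <;> simp
      map_smul' := fun c v ↦ by ext <;> simp }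
  have hs : Function.Surjective T := by
    rintro ⟨a, b, c⟩
    refine ⟨b • F.l x + a • F.n x + ∑ i, c i • F.m i x, ?_⟩
    refine Prod.ext ?_ (Prod.ext ?_ (funext fun j ↦ ?_))
    · change G x _ (F.l x) = a
      rw [map_add, add_apply, hF.sum_m_l hG hx]
      simp [hF.ll x hx, hF.nl hG hx]
    · change G x _ (F.n x) = b
      rw [map_add, add_apply, hF.sum_m_n hG hx]
      simp [hF.ln x hx, hF.nn x hx]
    · change G x _ (F.m j x) = c j
      rw [map_add, add_apply, hF.sum_m_m hx]
      simp [hF.lm x hx, hF.nm x hx]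
  have hfin : Module.finrank ℝ (Model d) = Module.finrank ℝ (ℝ × ℝ × (Fin (d - 2) → ℝ)) := by
    simp
    omega
  exact (LinearMap.injective_iff_surjective_of_finrank_eq_finrank hfin).2 hs
    (Prod.ext hl (Prod.ext hn (funext hm)))

theorem expand (hG : IsMetricOn G U) (hd : 2 ≤ d) (hF : IsNullFrame G U F) (hx : x ∈ U)
    (v : Model d) : v = G x v (F.n x) • F.l x + G x v (F.l x) • F.n x
      + ∑ i, G x v (F.m i x) • F.m i x := by
  refine hF.ext hG hd hx ?_ ?_ fun j ↦ ?_
  · rw [map_add, add_apply, hF.sum_m_l hG hx]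
    simp [hF.ll x hx, hF.nl hG hx]
  · rw [map_add, add_apply, hF.sum_m_n hG hx]
    simp [hF.ln x hx, hF.nn x hx]
  · rw [map_add, add_apply, hF.sum_m_m hx]
    simp [hF.lm x hx, hF.nm x hx]

theorem eq_smul_l (hG : IsMetricOn G U) (hd : 2 ≤ d) (hF : IsNullFrame G U F) (hx : x ∈ U)
    {v : Model d} (hl : G x (F.l x) v = 0) (hm : ∀ i, G x (F.m i x) v = 0) :
    v = G x v (F.n x) • F.l x := by
  have h := hF.expand hG hd hx v
  simp only [hG.symm x hx v (F.l x), hl, hG.symm x hx v (F.m _ x), hm] at h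
  simpa using h

theorem contDiffAt_l (hG : IsMetricOn G U) (hF : IsNullFrame G U F) (hx : x ∈ U) :
    ContDiffAt ℝ ∞ F.l x := hF.smooth_l.contDiffAt (hG.isOpen.mem_nhds hx)

theorem contDiffAt_n (hG : IsMetricOn G U) (hF : IsNullFrame G U F) (hx : x ∈ U) :
    ContDiffAt ℝ ∞ F.n x := hF.smooth_n.contDiffAt (hG.isOpen.mem_nhds hx)

theorem contDiffAt_m (hG : IsMetricOn G U) (hF : IsNullFrame G U F) (hx : x ∈ U)
    (i : Fin (d - 2)) : ContDiffAt ℝ ∞ (F.m i) x :=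
  (hF.smooth_m i).contDiffAt (hG.isOpen.mem_nhds hx)

end IsNullFrame

theorem IsMetricOn.contDiffAt_covDeriv (hG : IsMetricOn G U) (hx : x ∈ U)
    {Y Z : Model d → Model d} (hY : ContDiffAt ℝ ∞ Y x) (hZ : ContDiffAt ℝ ∞ Z x) :
    ContDiffAt ℝ ∞ (fun y ↦ covDeriv G Z y (Y y)) x := by
  have h1 : ContDiffAt ℝ ∞ (fderiv ℝ Z) x := hZ.fderiv_right (by simp)
  exact (h1.clm_apply hY).add (((hG.contDiffAt_christoffelL hx).clm_apply hY).clm_apply hZ)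

theorem IsMetricOn.contDiffAt_inner (hG : IsMetricOn G U) (hx : x ∈ U)
    {Y Z : Model d → Model d} (hY : ContDiffAt ℝ ∞ Y x) (hZ : ContDiffAt ℝ ∞ Z x) :
    ContDiffAt ℝ ∞ (fun y ↦ G y (Y y) (Z y)) x :=
  ((hG.contDiffAt hx).clm_apply hY).clm_apply hZ

theorem IsMetricOn.covDeriv_inner_const (hG : IsMetricOn G U) (hx : x ∈ U)
    {Y Z : Model d → Model d} (hY : ContDiffAt ℝ ∞ Y x) (hZ : ContDiffAt ℝ ∞ Z x) {c : ℝ}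
    (h : ∀ y ∈ U, G y (Y y) (Z y) = c) (v : Model d) :
    G x (covDeriv G Y x v) (Z x) + G x (Y x) (covDeriv G Z x v) = 0 := by
  rw [← hG.hasFDerivAt_inner hx (hY.differentiableAt (by simp)) (hZ.differentiableAt (by simp))]
  have h' : (fun y ↦ G y (Y y) (Z y)) =ᶠ[𝓝 x] fun _ ↦ c := by
    filter_upwards [hG.isOpen.mem_nhds hx] with y hy using h y hy
  rw [h'.fderiv_eq]
  simp

theorem covDeriv_sub_smul {Y Z : Model d → Model d} {f : Model d → ℝ}
    (hY : DifferentiableAt ℝ Y x) (hZ : DifferentiableAt ℝ Z x) (hf : DifferentiableAt ℝ f x)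
    (v : Model d) :
    covDeriv G (fun y ↦ Y y - f y • Z y) x v
      = covDeriv G Y x v - (f x • covDeriv G Z x v + fderiv ℝ f x v • Z x) := by
  have h := hY.hasFDerivAt.sub (hf.hasFDerivAt.smul hZ.hasFDerivAt)
  rw [covDeriv_eq, covDeriv_eq, covDeriv_eq]
  have h' : (fun y ↦ Y y - f y • Z y) = Y - f • Z := rfl
  rw [h', h.fderiv]
  simp only [sub_apply, add_apply, map_sub, map_smul, smul_add,
    smul_apply, ContinuousLinearMap.smulRight_apply]
  abel

namespace IsNullFrame

theorem l_covDeriv_l (hG : IsMetricOn G U) (hF : IsNullFrame G U F) (hx : x ∈ U) (v : Model d) :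
    G x (F.l x) (covDeriv G F.l x v) = 0 := by
  have h := hG.covDeriv_inner_const hx (hF.contDiffAt_l hG hx) (hF.contDiffAt_l hG hx) hF.ll v
  rw [hG.symm x hx (covDeriv G F.l x v)] at h
  linarith

theorem m_covDeriv_l (hG : IsMetricOn G U) (hd : 2 ≤ d) (hF : IsNullFrame G U F) (hx : x ∈ U)
    (v : Model d) (i : Fin (d - 2)) :
    G x (F.m i x) (covDeriv G F.l x v) = G x v (F.n x) * F.kappa G x i
      + G x v (F.l x) * F.tau G x i + (F.rho G x *ᵥ fun j ↦ G x v (F.m j x)) i := by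
  conv_lhs => rw [hF.expand hG hd hx v]
  rw [covDeriv_add, covDeriv_add, covDeriv_smul, covDeriv_smul, covDeriv_sum]
  simp only [map_add, map_smul, map_sum, covDeriv_smul, smul_eq_mul, Frame.kappa, Frame.tau,
    Matrix.mulVec, dotProduct, Frame.rho, Matrix.of_apply]
  congr 1
  exact Finset.sum_congr rfl fun j _ ↦ mul_comm _ _

theorem covDeriv_l_l (hG : IsMetricOn G U) (hd : 2 ≤ d) (hF : IsNullFrame G U F) (hx : x ∈ U)
    (hk : F.kappa G x = 0) : ∃ c : ℝ, covDeriv G F.l x (F.l x) = c • F.l x :=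
  ⟨_, hF.eq_smul_l hG hd hx (hF.l_covDeriv_l hG hx _) (congrFun hk)⟩

theorem covDeriv_n_l (hG : IsMetricOn G U) (hd : 2 ≤ d) (hF : IsNullFrame G U F) (hx : x ∈ U)
    (ht : F.tau G x = 0) : ∃ c : ℝ, covDeriv G F.l x (F.n x) = c • F.l x :=
  ⟨_, hF.eq_smul_l hG hd hx (hF.l_covDeriv_l hG hx _) (congrFun ht)⟩

theorem tau_eq_zero_of_covDeriv (hG : IsMetricOn G U) (hF : IsNullFrame G U F) (hx : x ∈ U)
    {c : ℝ} (h : covDeriv G F.l x (F.n x) = c • F.l x) : F.tau G x = 0 := by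
  funext i
  simp [Frame.tau, h, hF.ml hG hx]

/-- A null vector `v` with `ℓ·v = 1` and `∇_v ℓ ∝ ℓ` is unique if `det ρ ≠ 0`. -/
theorem eq_n (hG : IsMetricOn G U) (hd : 2 ≤ d) (hF : IsNullFrame G U F) (hx : x ∈ U)
    (hk : F.kappa G x = 0) (ht : F.tau G x = 0) (hr : (F.rho G x).det ≠ 0) {v : Model d} {c : ℝ}
    (hvv : G x v v = 0) (hlv : G x (F.l x) v = 1) (hv : covDeriv G F.l x v = c • F.l x) :
    v = F.n x := by
  have hz : (fun j ↦ G x v (F.m j x)) = 0 := by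
    refine Matrix.eq_zero_of_mulVec_eq_zero hr (funext fun i ↦ ?_)
    have h := hF.m_covDeriv_l hG hd hx v i
    rw [hk, ht, hv, map_smul, hF.ml hG hx] at h
    simpa using h.symm
  have hz' : ∀ j, G x v (F.m j x) = 0 := congrFun hz
  have h := hF.expand hG hd hx v
  rw [hG.symm x hx v (F.l x), hlv] at h
  simp only [hz', zero_smul, Finset.sum_const_zero, add_zero, one_smul] at h
  have h2 : G x v v = 2 * G x v (F.n x) := by
    conv_lhs => rw [h]
    simp only [map_add, map_smul, add_apply, smul_apply, hF.ll x hx, hF.nn x hx, hF.ln x hx,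
      hF.nl hG hx]
    simp
    ring
  have h3 : G x v (F.n x) = 0 := by linarith
  rw [h3] at h
  simpa using h

/-- With `κ = τ = 0`, `det ρ ≠ 0` and `R_{010i} = 0`, also `τ' = 0`. -/
theorem tau'_eq_zero (hG : IsMetricOn G U) (hd : 2 ≤ d) (hF : IsNullFrame G U F)
    (hk : ∀ y ∈ U, F.kappa G y = 0) (ht : ∀ y ∈ U, F.tau G y = 0)
    (hr : ∀ y ∈ U, (F.rho G y).det ≠ 0)
    (hR : ∀ y ∈ U, ∀ i, riemann G y (F.l y) (F.n y) (F.l y) (F.m i y) = 0) (hx : x ∈ U) :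
    F.tau' G x = 0 := by
  have cl : ∀ y ∈ U, ContDiffAt ℝ ∞ F.l y := fun y hy ↦ hF.contDiffAt_l hG hy
  have cn : ∀ y ∈ U, ContDiffAt ℝ ∞ F.n y := fun y hy ↦ hF.contDiffAt_n hG hy
  have cm : ∀ i, ∀ y ∈ U, ContDiffAt ℝ ∞ (F.m i) y := fun i y hy ↦ hF.contDiffAt_m hG hy i
  have hml : ∀ i, ∀ y ∈ U, ∀ v, G y (covDeriv G (F.m i) y v) (F.l y)
      = -G y (F.m i y) (covDeriv G F.l y v) := fun i y hy v ↦ by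
    linarith [hG.covDeriv_inner_const hy (cm i y hy) (cl y hy) (fun y hy ↦ hF.ml hG hy i) v]
  obtain ⟨f, hf⟩ := hF.covDeriv_l_l hG hd hx (hk x hx)
  obtain ⟨h, hh⟩ := hF.covDeriv_n_l hG hd hx (ht x hx)
  set w : Model d := covDeriv G F.n x (F.l x) - covDeriv G F.l x (F.n x) with hw
  have hnl : ∀ i, ∀ y ∈ U, G y (covDeriv G (F.m i) y (F.n y)) (F.l y) = 0 := fun i y hy ↦ by
    rw [hml i y hy]
    exact neg_eq_zero.2 (congrFun (ht y hy) i)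
  have hll : ∀ i, ∀ y ∈ U, G y (covDeriv G (F.m i) y (F.l y)) (F.l y) = 0 := fun i y hy ↦ by
    rw [hml i y hy]
    exact neg_eq_zero.2 (congrFun (hk y hy) i)
  have hwm : ∀ i, G x (F.m i x) (covDeriv G F.l x w) = 0 := by
    intro i
    have e := hR x hx i
    rw [riemann, curvature_eq hG hx ((cl x hx).differentiableAt (by simp))
      ((cn x hx).differentiableAt (by simp)) (cm i x hx)] at e
    have e1 := hG.covDeriv_inner_const hx (hG.contDiffAt_covDeriv hx (cn x hx) (cm i x hx))
      (cl x hx) (hnl i) (F.l x)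
    have e2 := hG.covDeriv_inner_const hx (hG.contDiffAt_covDeriv hx (cl x hx) (cm i x hx))
      (cl x hx) (hll i) (F.n x)
    rw [hf, map_smul, hnl i x hx, smul_zero, add_zero] at e1
    rw [hh, map_smul, hll i x hx, smul_zero, add_zero] at e2
    rw [map_sub, map_sub, sub_apply, sub_apply, e1, e2, ← hw, hml i x hx] at e
    linarith
  refine Matrix.eq_zero_of_mulVec_eq_zero (hr x hx) (funext fun i ↦ ?_)
  have e := hF.m_covDeriv_l hG hd hx w i
  rw [hwm i, hk x hx, ht x hx] at e
  have e3 : (fun j ↦ G x w (F.m j x)) = F.tau' G x := by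
    funext j
    rw [hw, hh, map_sub, sub_apply, map_smul, smul_apply, hF.lm x hx, smul_zero, sub_zero,
      hG.symm x hx, Frame.tau']
  rw [e3] at e
  simpa using e.symm

end IsNullFrame

theorem weyl_eq_riemann (hF : IsNullFrame G U F) (hx : x ∈ U) {Λ : ℝ}
    (hE : ∀ v w, ricci G x v w = Λ * G x v w) (i : Fin (d - 2)) :
    weyl G x (F.l x) (F.n x) (F.l x) (F.m i x)
      = riemann G x (F.l x) (F.n x) (F.l x) (F.m i x) := by
  simp [weyl, hE, hF.ll x hx, hF.lm x hx]

/-! ### Null rotations -/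

namespace IsNullFrame

variable {z : Model d → Fin (d - 2) → ℝ}

theorem n_nullRotate_l (hG : IsMetricOn G U) (hF : IsNullFrame G U F) (hx : x ∈ U) :
    G x ((F.nullRotate z).n x) (F.l x) = 1 := by
  simp only [Frame.nullRotate]
  rw [map_sub, map_add, sub_apply, add_apply, hF.sum_m_l hG hx, map_smul, smul_apply,
    hF.ll x hx, hF.nl hG hx]
  simp

theorem n_nullRotate_n (hG : IsMetricOn G U) (hF : IsNullFrame G U F) (hx : x ∈ U) :
    G x ((F.nullRotate z).n x) (F.n x) = -(1 / 2 * ∑ i, z x i ^ 2) := by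
  simp only [Frame.nullRotate]
  rw [map_sub, map_add, sub_apply, add_apply, hF.sum_m_n hG hx, map_smul, smul_apply,
    hF.nn x hx, hF.ln x hx]
  simp

theorem n_nullRotate_m (hF : IsNullFrame G U F) (hx : x ∈ U) (i : Fin (d - 2)) :
    G x ((F.nullRotate z).n x) (F.m i x) = z x i := by
  simp only [Frame.nullRotate]
  rw [map_sub, map_add, sub_apply, add_apply, hF.sum_m_m hx, map_smul, smul_apply,
    hF.nm x hx, hF.lm x hx]
  simp

theorem nullRotate (hG : IsMetricOn G U) (hF : IsNullFrame G U F) (hz : ContDiffOn ℝ ∞ z U) :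
    IsNullFrame G U (F.nullRotate z) where
  smooth_l := hF.smooth_l
  smooth_n := by
    have hz' := contDiffOn_pi.1 hz
    exact (hF.smooth_n.add (ContDiffOn.sum fun i _ ↦ (hz' i).smul (hF.smooth_m i))).sub
      ((contDiffOn_const.mul (ContDiffOn.sum fun i _ ↦ (hz' i).pow 2)).smul hF.smooth_l)
  smooth_m i := (hF.smooth_m i).sub ((contDiffOn_pi.1 hz i).smul hF.smooth_l)
  ll := hF.ll
  nn x hx := by
    conv_lhs => enter [2]; simp only [Frame.nullRotate]
    rw [map_sub, map_add, map_smul, map_sum, hF.n_nullRotate_n hG hx, hF.n_nullRotate_l hG hx]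
    simp only [map_smul, hF.n_nullRotate_m hx, smul_eq_mul, ← sq]
    ring
  ln x hx := by
    rw [hG.symm x hx]
    exact hF.n_nullRotate_l hG hx
  lm x hx i := by
    simp [Frame.nullRotate, hF.lm x hx, hF.ll x hx]
  nm x hx i := by
    have h : (F.nullRotate z).m i x = F.m i x - z x i • F.l x := rfl
    rw [h, map_sub, map_smul, hF.n_nullRotate_m hx, hF.n_nullRotate_l hG hx]
    simp
  mm x hx i j := by
    simp [Frame.nullRotate, hF.lm x hx, hF.ll x hx, hF.ml hG hx, hF.mm x hx]

theorem tau_nullRotate (hG : IsMetricOn G U) (hd : 2 ≤ d) (hF : IsNullFrame G U F) (hx : x ∈ U)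
    (hk : F.kappa G x = 0) :
    (F.nullRotate z).tau G x = F.tau G x + F.rho G x *ᵥ z x := by
  funext i
  have h : (F.nullRotate z).tau G x i
    = G x (F.m i x - z x i • F.l x) (covDeriv G F.l x ((F.nullRotate z).n x)) := rfl
  rw [h, map_sub, sub_apply, map_smul, smul_apply, hF.l_covDeriv_l hG hx,
    hF.m_covDeriv_l hG hd hx, hk, hF.n_nullRotate_l hG hx]
  simp only [hF.n_nullRotate_m hx]
  simp

theorem tau'_nullRotate (hG : IsMetricOn G U) (hF : IsNullFrame G U F)
    (hz : ContDiffOn ℝ ∞ z U) (hx : x ∈ U) (hk : F.kappa G x = 0) :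
    (F.nullRotate z).tau' G x = F.tau' G x + F.thorn G (-1) z x := by
  have hF' := hF.nullRotate hG hz
  have cl := hF.contDiffAt_l hG hx
  have cn := hF.contDiffAt_n hG hx
  have cm := fun i ↦ hF.contDiffAt_m hG hx i
  have cz : ∀ i, DifferentiableAt ℝ (fun y ↦ z y i) x := fun i ↦
    ((contDiffOn_pi.1 hz i).contDiffAt (hG.isOpen.mem_nhds hx)).differentiableAt (by simp)
  funext i
  have e1 := hG.covDeriv_inner_const hx (hF'.contDiffAt_m hG hx i) (hF'.contDiffAt_n hG hx)
    (fun y hy ↦ hF'.mn hG hy i) (F.l x)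
  have e2 : covDeriv G ((F.nullRotate z).m i) x (F.l x) = covDeriv G (F.m i) x (F.l x)
      - (z x i • covDeriv G F.l x (F.l x) + fderiv ℝ (fun y ↦ z y i) x (F.l x) • F.l x) :=
    covDeriv_sub_smul ((cm i).differentiableAt (by simp)) (cl.differentiableAt (by simp)) (cz i) _
  have e3 : G x (covDeriv G F.l x (F.l x)) ((F.nullRotate z).n x) = F.L10 G x := by
    rw [hG.symm x hx]
    simp only [Frame.nullRotate, map_sub, map_add, sub_apply, add_apply, map_smul, smul_apply,
      map_sum, sum_apply, hF.l_covDeriv_l hG hx, Frame.L10]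
    have : ∀ j, G x (F.m j x) (covDeriv G F.l x (F.l x)) = 0 := congrFun hk
    simp [this]
  have e4 : G x (F.l x) ((F.nullRotate z).n x) = 1 := hF'.ln x hx
  have e5 := hG.covDeriv_inner_const hx (cm i) cn (fun y hy ↦ hF.mn hG hy i) (F.l x)
  have e6 : ∀ j, G x (covDeriv G (F.m i) x (F.l x)) (F.m j x) = -F.M0 G j i x := fun j ↦ by
    rw [Frame.M0]
    linarith [hG.covDeriv_inner_const hx (cm i) (cm j) (fun y hy ↦ hF.mm y hy i j) (F.l x)]
  have e7 : G x (covDeriv G (F.m i) x (F.l x)) (F.l x) = 0 := by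
    have := hG.covDeriv_inner_const hx (cm i) cl (fun y hy ↦ hF.ml hG hy i) (F.l x)
    have h' := congrFun hk i
    simp only [Frame.kappa, Pi.zero_apply] at h'
    linarith
  have e8 : G x (covDeriv G (F.m i) x (F.l x)) ((F.nullRotate z).n x)
      = -F.tau' G x i - ∑ k, F.M0 G k i x * z x k := by
    have e9 : ∑ k, z x k * -F.M0 G k i x = -∑ k, F.M0 G k i x * z x k := by
      rw [← Finset.sum_neg_distrib]
      exact Finset.sum_congr rfl fun k _ ↦ by ring
    simp only [Frame.nullRotate, map_sub, map_add, map_smul, map_sum, e6, e7, smul_eq_mul, e9,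
      Frame.tau']
    linarith
  rw [e2, map_sub, map_add, map_smul, map_smul, sub_apply, add_apply, smul_apply, smul_apply, e3,
    e4, e8] at e1
  have e10 : (F.nullRotate z).tau' G x i
    = G x ((F.nullRotate z).m i x) (covDeriv G (F.nullRotate z).n x (F.l x)) := rfl
  rw [e10, Pi.add_apply, Frame.thorn]
  simp only [smul_eq_mul] at e1
  push_cast
  linarith

end IsNullFrame

/-! ### Smoothness of `ρ⁻¹ τ` -/

theorem contDiffAt_det {E ι : Type*} [NormedAddCommGroup E] [NormedSpace ℝ E] [Fintype ι]
    [DecidableEq ι] {A : E → Matrix ι ι ℝ} {y : E}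
    (hA : ∀ i j, ContDiffAt ℝ ∞ (fun w ↦ A w i j) y) : ContDiffAt ℝ ∞ (fun w ↦ (A w).det) y := by
  simp only [Matrix.det_apply']
  exact ContDiffAt.sum fun σ _ ↦ contDiffAt_const.mul (contDiffAt_prod fun i _ ↦ hA _ _)

theorem contDiffAt_matrix_inv {E ι : Type*} [NormedAddCommGroup E] [NormedSpace ℝ E] [Fintype ι]
    [DecidableEq ι] {A : E → Matrix ι ι ℝ} {y : E}
    (hA : ∀ i j, ContDiffAt ℝ ∞ (fun w ↦ A w i j) y) (hdet : (A y).det ≠ 0) (i j : ι) :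
    ContDiffAt ℝ ∞ (fun w ↦ (A w)⁻¹ i j) y := by
  simp only [Matrix.inv_def, Ring.inverse_eq_inv', Matrix.smul_apply, Matrix.adjugate_apply,
    smul_eq_mul]
  refine ((contDiffAt_det hA).inv hdet).mul (contDiffAt_det fun k l ↦ ?_)
  simp only [Matrix.updateRow_apply]
  split_ifs
  · exact contDiffAt_const
  · exact hA k l

theorem IsNullFrame.contDiffOn_rho_inv_tau (hG : IsMetricOn G U) (hF : IsNullFrame G U F)
    (hr : ∀ y ∈ U, (F.rho G y).det ≠ 0) :
    ContDiffOn ℝ ∞ (fun x ↦ -((F.rho G x)⁻¹ *ᵥ F.tau G x)) U := by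
  intro x hx
  refine ContDiffAt.contDiffWithinAt (contDiffAt_pi.2 fun i ↦ ?_)
  have ht : ∀ j, ContDiffAt ℝ ∞ (fun y ↦ F.tau G y j) x := fun j ↦
    hG.contDiffAt_inner hx (hF.contDiffAt_m hG hx j)
      (hG.contDiffAt_covDeriv hx (hF.contDiffAt_n hG hx) (hF.contDiffAt_l hG hx))
  have hρ : ∀ j k, ContDiffAt ℝ ∞ (fun y ↦ F.rho G y j k) x := fun j k ↦
    hG.contDiffAt_inner hx (hF.contDiffAt_m hG hx j)
      (hG.contDiffAt_covDeriv hx (hF.contDiffAt_m hG hx k) (hF.contDiffAt_l hG hx))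
  simp only [Pi.neg_apply, Matrix.mulVec, dotProduct]
  exact (ContDiffAt.sum fun j _ ↦ (contDiffAt_matrix_inv hρ (hr x hx) i j).mul (ht j)).neg

end FrameAlgebra

section FrameExistence

variable {d : ℕ}

/-- The orthogonal complement of a timelike vector is positive definite. -/
theorem lorentz_pos_of_orthogonal (hd : 0 < d) {E : Type*} [AddCommGroup E] [Module ℝ E]
    (B : E →ₗ[ℝ] E →ₗ[ℝ] ℝ) (b : Module.Basis (Fin d) ℝ E)
    (hb : ∀ i j, B (b i) (b j) = if i = j then (if (i : ℕ) = 0 then -1 else 1) else 0)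
    {u w : E} (hu : B u u < 0) (huw : B u w = 0) (hw : w ≠ 0) : 0 < B w w := by
  let o : Fin d := ⟨0, hd⟩
  have key : ∀ v v' : E, B v v' = -(b.repr v o * b.repr v' o)
      + ∑ i ∈ Finset.univ.erase o, b.repr v i * b.repr v' i := by
    intro v v'
    conv_lhs => rw [← b.sum_repr v, ← b.sum_repr v']
    simp only [map_sum, LinearMap.sum_apply, map_smul, LinearMap.smul_apply, hb, smul_eq_mul,
      mul_ite, mul_zero, Finset.sum_ite_eq', Finset.mem_univ, if_true]
    rw [← Finset.add_sum_erase _ _ (Finset.mem_univ o)]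
    congr 1
    · simp [o]
      ring
    · refine Finset.sum_congr rfl fun i hi ↦ ?_
      have : (i : ℕ) ≠ 0 := fun h ↦ (Finset.ne_of_mem_erase hi) (Fin.ext h)
      simp [this]
      ring
  rw [key] at hu huw ⊢
  have cs := Finset.sum_mul_sq_le_sq_mul_sq (Finset.univ.erase o) (fun i ↦ b.repr u i)
    fun i ↦ b.repr w i
  simp only [← sq] at hu ⊢
  set a := ∑ i ∈ Finset.univ.erase o, b.repr u i ^ 2
  set c := ∑ i ∈ Finset.univ.erase o, b.repr w i ^ 2 with hc
  set p := ∑ i ∈ Finset.univ.erase o, b.repr u i * b.repr w i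
  have hp : p = b.repr u o * b.repr w o := by linarith
  rw [hp, mul_pow] at cs
  by_contra hneg
  have ha : 0 ≤ a := Finset.sum_nonneg fun i _ ↦ sq_nonneg _
  have hcw : c ≤ b.repr w o ^ 2 := by linarith
  have h1 : b.repr w o ^ 2 * (b.repr u o ^ 2 - a) ≤ 0 := by
    nlinarith [mul_le_mul_of_nonneg_left hcw ha]
  have h2 : b.repr w o ^ 2 = 0 := by
    refine le_antisymm ?_ (sq_nonneg _)
    exact nonpos_of_mul_nonpos_left h1 (by linarith)
  have h3 : c = 0 := le_antisymm (by linarith) (Finset.sum_nonneg fun i _ ↦ sq_nonneg _)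
  refine hw (b.ext_elem fun i ↦ ?_)
  rw [map_zero, Finsupp.zero_apply]
  by_cases hi : i = o
  · rw [hi]
    exact pow_eq_zero_iff two_ne_zero |>.1 h2
  · have h4 := (Finset.sum_eq_zero_iff_of_nonneg fun i _ ↦ sq_nonneg (b.repr w i)).1 h3 i
      (Finset.mem_erase.2 ⟨hi, Finset.mem_univ i⟩)
    exact pow_eq_zero_iff two_ne_zero |>.1 h4

/-- The complement of a null pair in a Lorentzian vector space has an orthonormal basis. -/
theorem exists_orthonormal_of_null_pair (hd : 2 ≤ d) {E : Type*} [AddCommGroup E] [Module ℝ E]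
    (B : E →ₗ[ℝ] E →ₗ[ℝ] ℝ) (hB : ∀ v w, B v w = B w v) (b : Module.Basis (Fin d) ℝ E)
    (hb : ∀ i j, B (b i) (b j) = if i = j then (if (i : ℕ) = 0 then -1 else 1) else 0)
    {l n : E} (hll : B l l = 0) (hnn : B n n = 0) (hln : B l n = 1) :
    ∃ e : Fin (d - 2) → E, (∀ i j, B (e i) (e j) = if i = j then 1 else 0) ∧
      (∀ i, B (e i) l = 0) ∧ ∀ i, B (e i) n = 0 := by
  have : FiniteDimensional ℝ E := b.finiteDimensional_of_finite
  have hnl : B n l = 1 := by rw [hB, hln]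
  let T : E →ₗ[ℝ] ℝ × ℝ := (B l).prod (B n)
  have hT : Function.Surjective T := by
    rintro ⟨p, q⟩
    refine ⟨q • l + p • n, ?_⟩
    simp [T, hll, hnn, hln, hnl]
  let W := LinearMap.ker T
  have hmem : ∀ w : W, B l w = 0 ∧ B n w = 0 := fun w ↦ by
    have h : (B l w, B n w) = ((0, 0) : ℝ × ℝ) := LinearMap.mem_ker.1 w.2
    exact ⟨congrArg Prod.fst h, congrArg Prod.snd h⟩
  have hfin : Module.finrank ℝ W = d - 2 := by
    have h := LinearMap.finrank_range_add_finrank_ker T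
    rw [LinearMap.range_eq_top.2 hT, finrank_top, Module.finrank_eq_card_basis b] at h
    simp only [Module.finrank_prod, Module.finrank_self, Fintype.card_fin] at h
    change 1 + 1 + Module.finrank ℝ W = d at h
    omega
  have hpos : ∀ w : W, w ≠ 0 → 0 < B w w := fun w hw ↦ by
    obtain ⟨h1, h2⟩ := hmem w
    refine lorentz_pos_of_orthogonal (by omega) B b hb (u := l - n) ?_ ?_
      (fun h ↦ hw (Subtype.ext h))
    · simp [hll, hnn, hln, hnl]
    · simp [h1, h2]
  let B' : LinearMap.BilinForm ℝ W := B.compl₁₂ W.subtype W.subtype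
  have hB' : LinearMap.IsSymm B' := ⟨fun v w ↦ hB _ _⟩
  obtain ⟨v, hv⟩ := LinearMap.BilinForm.exists_orthogonal_basis hB'
  have hvp : ∀ i, 0 < B (v i) (v i) := fun i ↦ hpos _ (v.ne_zero i)
  let c : Fin (d - 2) → Fin (Module.finrank ℝ W) := finCongr hfin.symm
  refine ⟨fun i ↦ (Real.sqrt (B (v (c i)) (v (c i))))⁻¹ • (v (c i) : E), fun i j ↦ ?_,
    fun i ↦ ?_, fun i ↦ ?_⟩
  · by_cases hij : i = j
    · subst hij
      have h := Real.mul_self_sqrt (hvp (c i)).le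
      have h0 : Real.sqrt (B (v (c i)) (v (c i))) ≠ 0 := (Real.sqrt_pos.2 (hvp (c i))).ne'
      simp only [map_smul, LinearMap.smul_apply, smul_eq_mul, if_true]
      nth_rewrite 3 [← h]
      field_simp
    · have h : B (v (c i)) (v (c j)) = 0 := by
        refine hv fun h ↦ hij ?_
        simpa [c] using h
      simp [h, hij]
  · rw [map_smul, LinearMap.smul_apply, hB _ l, (hmem _).1, smul_zero]
  · rw [map_smul, LinearMap.smul_apply, hB _ n, (hmem _).2, smul_zero]

variable {G : Metric d} {V : Set (Model d)} {y₀ : Model d}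

theorem IsMetricOn.contDiffOn_inner (hG : IsMetricOn G V) {Y Z : Model d → Model d}
    (hY : ContDiffOn ℝ ∞ Y V) (hZ : ContDiffOn ℝ ∞ Z V) :
    ContDiffOn ℝ ∞ (fun y ↦ G y (Y y) (Z y)) V :=
  (hG.smooth.clm_apply hY).clm_apply hZ

/-- Smooth Gram–Schmidt orthonormalisation in the complement of a null pair. -/
theorem exists_smooth_orthonormal (hG : IsMetricOn G V) (hy : y₀ ∈ V) {l n : Model d → Model d}
    (hl : ContDiffOn ℝ ∞ l V) (hn : ContDiffOn ℝ ∞ n V) (hll : ∀ y ∈ V, G y (l y) (l y) = 0)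
    (hnn : ∀ y ∈ V, G y (n y) (n y) = 0) (hln : ∀ y ∈ V, G y (l y) (n y) = 1) (k : ℕ)
    (e : Fin k → Model d) (he : ∀ i j, G y₀ (e i) (e j) = if i = j then 1 else 0)
    (hel : ∀ i, G y₀ (e i) (l y₀) = 0) (hen : ∀ i, G y₀ (e i) (n y₀) = 0) :
    ∃ U : Set (Model d), IsOpen U ∧ U ⊆ V ∧ y₀ ∈ U ∧ ∃ m : Fin k → Model d → Model d,
      (∀ i, ContDiffOn ℝ ∞ (m i) U) ∧ (∀ i, m i y₀ = e i) ∧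
      (∀ y ∈ U, ∀ i, G y (l y) (m i y) = 0) ∧ (∀ y ∈ U, ∀ i, G y (n y) (m i y) = 0) ∧
      ∀ y ∈ U, ∀ i j, G y (m i y) (m j y) = if i = j then 1 else 0 := by
  induction k with
  | zero => exact ⟨V, hG.isOpen, subset_rfl, hy, fun i ↦ i.elim0, fun i ↦ i.elim0,
      fun i ↦ i.elim0, fun _ _ i ↦ i.elim0, fun _ _ i ↦ i.elim0, fun _ _ i ↦ i.elim0⟩
  | succ k ih =>
    obtain ⟨U, hU, hUV, hyU, m, hm, hm0, hlm, hnm, hmm⟩ := ih (fun i ↦ e i.succ)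
      (fun i j ↦ by simp [he]) (fun i ↦ hel _) (fun i ↦ hen _)
    have hGU := hG.mono hU hUV
    have hlU := hl.mono hUV
    have hnU := hn.mono hUV
    let v : Model d → Model d := fun y ↦ e 0 - G y (e 0) (n y) • l y - G y (e 0) (l y) • n y
      - ∑ i, G y (e 0) (m i y) • m i y
    have hv : ContDiffOn ℝ ∞ v U :=
      ((contDiffOn_const.sub ((hGU.contDiffOn_inner contDiffOn_const hnU).smul hlU)).sub
        ((hGU.contDiffOn_inner contDiffOn_const hlU).smul hnU)).sub
        (ContDiffOn.sum fun i _ ↦ (hGU.contDiffOn_inner contDiffOn_const (hm i)).smul (hm i))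
    have hml : ∀ y ∈ U, ∀ i, G y (m i y) (l y) = 0 := fun y hy i ↦ by
      rw [hGU.symm y hy, hlm y hy]
    have hmn : ∀ y ∈ U, ∀ i, G y (m i y) (n y) = 0 := fun y hy i ↦ by
      rw [hGU.symm y hy, hnm y hy]
    have hnl : ∀ y ∈ U, G y (n y) (l y) = 1 := fun y hy ↦ by
      rw [hGU.symm y hy, hln y (hUV hy)]
    have hvl : ∀ y ∈ U, G y (v y) (l y) = 0 := fun y hy ↦ by
      simp [v, hll y (hUV hy), hnl y hy, hml y hy, map_sum, sum_apply]
    have hvn : ∀ y ∈ U, G y (v y) (n y) = 0 := fun y hy ↦ by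
      simp [v, hnn y (hUV hy), hln y (hUV hy), hmn y hy, map_sum, sum_apply]
    have hvm : ∀ y ∈ U, ∀ i, G y (v y) (m i y) = 0 := fun y hy i ↦ by
      simp [v, hlm y hy, hnm y hy, hmm y hy, map_sum, sum_apply]
    have hv0 : v y₀ = e 0 := by
      have h : ∀ i : Fin k, G y₀ (e 0) (e i.succ) = 0 := fun i ↦ by
        rw [he, if_neg (Fin.succ_ne_zero i).symm]
      simp [v, hel, hen, hm0, h]
    have hvv : ContDiffOn ℝ ∞ (fun y ↦ G y (v y) (v y)) U := hGU.contDiffOn_inner hv hv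
    have hvv0 : G y₀ (v y₀) (v y₀) = 1 := by rw [hv0, he, if_pos rfl]
    let U' := U ∩ (fun y ↦ G y (v y) (v y)) ⁻¹' Set.Ioi 0
    have hpos : ∀ y ∈ U', 0 < G y (v y) (v y) := fun y hy ↦ hy.2
    have hU'U : U' ⊆ U := Set.inter_subset_left
    let m₀ : Model d → Model d := fun y ↦ (Real.sqrt (G y (v y) (v y)))⁻¹ • v y
    have hm₀ : ContDiffOn ℝ ∞ m₀ U' :=
      (((hvv.mono hU'U).sqrt fun y hy ↦ (hpos y hy).ne').inv
        fun y hy ↦ (Real.sqrt_pos.2 (hpos y hy)).ne').smul (hv.mono hU'U)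
    have h00 : ∀ y ∈ U', G y (m₀ y) (m₀ y) = 1 := fun y hy ↦ by
      have h := Real.mul_self_sqrt (hpos y hy).le
      have h0 : Real.sqrt (G y (v y) (v y)) ≠ 0 := (Real.sqrt_pos.2 (hpos y hy)).ne'
      simp only [m₀, map_smul, smul_apply, smul_eq_mul]
      nth_rewrite 3 [← h]
      field_simp
    have h0m : ∀ y ∈ U', ∀ i, G y (m₀ y) (m i y) = 0 := fun y hy i ↦ by
      simp only [m₀, map_smul, smul_apply, hvm y hy.1, smul_zero]
    have hm0' : ∀ y ∈ U', ∀ i, G y (m i y) (m₀ y) = 0 := fun y hy i ↦ by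
      rw [hGU.symm y hy.1, h0m y hy]
    refine ⟨U', hvv.continuousOn.isOpen_inter_preimage hU isOpen_Ioi, hU'U.trans hUV,
      ⟨hyU, by simp [hvv0]⟩, Fin.cons m₀ m, ?_, ?_, ?_, ?_, ?_⟩
    · intro i
      induction i using Fin.cases with
      | zero => simpa using hm₀
      | succ i => simpa using (hm i).mono hU'U
    · intro i
      induction i using Fin.cases with
      | zero => simp [m₀, hv0, he]
      | succ i => simpa using hm0 i
    · intro y hy i
      induction i using Fin.cases with
      | zero => simp [m₀, hGU.symm y hy.1 (l y) (v y), hvl y hy.1]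
      | succ i => simpa using hlm y hy.1 i
    · intro y hy i
      induction i using Fin.cases with
      | zero => simp [m₀, hGU.symm y hy.1 (n y) (v y), hvn y hy.1]
      | succ i => simpa using hnm y hy.1 i
    · intro y hy i j
      induction i using Fin.cases with
      | zero =>
        induction j using Fin.cases with
        | zero => simpa using h00 y hy
        | succ j => simpa [(Fin.succ_ne_zero j).symm] using h0m y hy j
      | succ i =>
        induction j using Fin.cases with
        | zero => simpa using hm0' y hy i
        | succ j => simpa using hmm y hy.1 i j

/-- A null field `ℓ` is locally completed to a smooth null frame. -/
theorem exists_isNullFrame (hd : 2 ≤ d) (hG : IsMetricOn G V) (hy : y₀ ∈ V)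
    (hL : ∃ b : Module.Basis (Fin d) ℝ (Model d), ∀ i j,
      G y₀ (b i) (b j) = if i = j then (if (i : ℕ) = 0 then -1 else 1) else 0)
    {l : Model d → Model d} (hl : ContDiffOn ℝ ∞ l V) (hll : ∀ y ∈ V, G y (l y) (l y) = 0)
    (h0 : l y₀ ≠ 0) :
    ∃ U : Set (Model d), IsOpen U ∧ U ⊆ V ∧ y₀ ∈ U ∧ ∃ F : Frame d, IsNullFrame G U F ∧ F.l = l := by
  obtain ⟨w, hw⟩ : ∃ w, G y₀ (l y₀) w ≠ 0 := by
    by_contra! h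
    exact h0 (hG.nondeg y₀ hy _ h)
  have hlw : ContDiffOn ℝ ∞ (fun y ↦ G y (l y) w) V := hG.contDiffOn_inner hl contDiffOn_const
  let V' := V ∩ (fun y ↦ G y (l y) w) ⁻¹' {0}ᶜ
  have hV' : IsOpen V' := hlw.continuousOn.isOpen_inter_preimage hG.isOpen isOpen_compl_singleton
  have hV'V : V' ⊆ V := Set.inter_subset_left
  have hy' : y₀ ∈ V' := ⟨hy, hw⟩
  have hG' := hG.mono hV' hV'V
  have hl' := hl.mono hV'V
  let w' : Model d → Model d := fun y ↦ (G y (l y) w)⁻¹ • w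
  have hw' : ContDiffOn ℝ ∞ w' V' := ((hlw.mono hV'V).inv fun y hy ↦ hy.2).smul contDiffOn_const
  have hlw' : ∀ y ∈ V', G y (l y) (w' y) = 1 := fun y hy ↦ by
    have : G y (l y) w ≠ 0 := hy.2
    simp [w', this]
  let n : Model d → Model d := fun y ↦ w' y - (1 / 2 * G y (w' y) (w' y)) • l y
  have hn : ContDiffOn ℝ ∞ n V' :=
    hw'.sub ((contDiffOn_const.mul (hG'.contDiffOn_inner hw' hw')).smul hl')
  have hln : ∀ y ∈ V', G y (l y) (n y) = 1 := fun y hy ↦ by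
    simp only [n, map_sub, map_smul, hlw' y hy, hll y hy.1, smul_zero, sub_zero]
  have hnn : ∀ y ∈ V', G y (n y) (n y) = 0 := fun y hy ↦ by
    simp only [n, map_sub, map_smul, sub_apply, smul_apply, hlw' y hy, hll y hy.1,
      hG'.symm y hy (w' y) (l y), smul_eq_mul]
    ring
  obtain ⟨b, hb⟩ := hL
  obtain ⟨e, he, hel, hen⟩ := exists_orthonormal_of_null_pair hd
    (LinearMap.mk₂ ℝ (fun v w ↦ G y₀ v w) (by simp) (by simp) (by simp) (by simp))
    (fun v w ↦ hG.symm y₀ hy v w) b hb (hll y₀ hy) (hnn y₀ hy') (hln y₀ hy')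
  obtain ⟨U, hU, hUV, hyU, m, hm, -, hlm, hnm, hmm⟩ := exists_smooth_orthonormal hG' hy' hl' hn
    (fun y hy ↦ hll y hy.1) hnn hln (d - 2) e he hel hen
  exact ⟨U, hU, hUV.trans hV'V, hyU, ⟨l, n, m⟩, ⟨hl'.mono hUV, hn.mono hUV, hm,
    fun y hy ↦ hll y (hUV hy).1, fun y hy ↦ hnn y (hUV hy), fun y hy ↦ hln y (hUV hy),
    hlm, hnm, hmm⟩, rfl⟩

end FrameExistence

/-! ### Covariance of the Levi-Civita derivative under local isometries -/

section Covariance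

variable {d : ℕ} {G G' : Metric d} {V V' : Set (Model d)} {θ : Model d → Model d} {x : Model d}

theorem fderiv_metric_pullback (hG : IsMetricOn G V) (hG' : IsMetricOn G' V')
    (hθ : ContDiffOn ℝ ∞ θ V) (hmaps : Set.MapsTo θ V V')
    (hiso : ∀ y ∈ V, ∀ u v, G y u v = G' (θ y) (fderiv ℝ θ y u) (fderiv ℝ θ y v))
    (hx : x ∈ V) (u v w : Model d) :
    fderiv ℝ G x u v w
      = fderiv ℝ G' (θ x) (fderiv ℝ θ x u) (fderiv ℝ θ x v) (fderiv ℝ θ x w)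
        + G' (θ x) (fderiv ℝ (fderiv ℝ θ) x u v) (fderiv ℝ θ x w)
        + G' (θ x) (fderiv ℝ θ x v) (fderiv ℝ (fderiv ℝ θ) x u w) := by
  have cθ := hθ.contDiffAt (hG.isOpen.mem_nhds hx)
  have dθ : DifferentiableAt ℝ θ x := cθ.differentiableAt (by simp)
  have ddθ : DifferentiableAt ℝ (fderiv ℝ θ) x :=
    (cθ.fderiv_right (m := ∞) (by simp)).differentiableAt (by simp)
  have h1 := ((hG.differentiableAt hx).hasFDerivAt.clm_apply (hasFDerivAt_const v x)).clm_apply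
    (hasFDerivAt_const w x)
  have h2 := (((hG'.differentiableAt (hmaps hx)).hasFDerivAt.comp x dθ.hasFDerivAt).clm_apply
    (ddθ.hasFDerivAt.clm_apply (hasFDerivAt_const v x))).clm_apply
    (ddθ.hasFDerivAt.clm_apply (hasFDerivAt_const w x))
  have h3 : (fun y ↦ G y v w)
      =ᶠ[𝓝 x] fun y ↦ (G' ∘ θ) y (fderiv ℝ θ y v) (fderiv ℝ θ y w) := by
    filter_upwards [hG.isOpen.mem_nhds hx] with y hy using hiso y hy v w
  have h4 := congrArg (fun f : Model d →L[ℝ] ℝ ↦ f u) (h1.unique (h2.congr_of_eventuallyEq h3))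
  simp at h4
  rw [h4]
  ring

theorem fderiv_christoffel_pullback (hG : IsMetricOn G V) (hG' : IsMetricOn G' V')
    (hθ : ContDiffOn ℝ ∞ θ V) (hmaps : Set.MapsTo θ V V')
    (hiso : ∀ y ∈ V, ∀ u v, G y u v = G' (θ y) (fderiv ℝ θ y u) (fderiv ℝ θ y v))
    (hx : x ∈ V) (hsurj : Function.Surjective (fderiv ℝ θ x)) (u v : Model d) :
    fderiv ℝ θ x (christoffel G x u v)
      = christoffel G' (θ x) (fderiv ℝ θ x u) (fderiv ℝ θ x v)
        + fderiv ℝ (fderiv ℝ θ) x u v := by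
  refine hG'.ext (hmaps hx) fun w' ↦ ?_
  obtain ⟨w, rfl⟩ := hsurj w'
  have hs : IsSymmSndFDerivAt ℝ θ x :=
    (hθ.contDiffAt (hG.isOpen.mem_nhds hx)).isSymmSndFDerivAt (by
      rw [minSmoothness_of_isRCLikeNormedField]; exact WithTop.coe_le_coe.2 (le_top (a := (2 : ℕ∞))))
  rw [← hiso x hx, hG.apply_christoffel hx, map_add, add_apply,
    hG'.apply_christoffel (hmaps hx)]
  simp only [fderiv_metric_pullback hG hG' hθ hmaps hiso hx]
  rw [hs.eq v u, hs.eq w u, hs.eq w v,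
    hG'.symm _ (hmaps hx) (fderiv ℝ θ x v) (fderiv ℝ (fderiv ℝ θ) x u w)]
  ring

theorem fderiv_covDeriv_pullback (hG : IsMetricOn G V) (hG' : IsMetricOn G' V')
    (hθ : ContDiffOn ℝ ∞ θ V) (hmaps : Set.MapsTo θ V V')
    (hiso : ∀ y ∈ V, ∀ u v, G y u v = G' (θ y) (fderiv ℝ θ y u) (fderiv ℝ θ y v))
    (hx : x ∈ V) (hsurj : Function.Surjective (fderiv ℝ θ x)) {Y Y' : Model d → Model d}
    (hY : DifferentiableAt ℝ Y x) (hY' : DifferentiableAt ℝ Y' (θ x))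
    (hYY' : ∀ y ∈ V, Y' (θ y) = fderiv ℝ θ y (Y y)) (v : Model d) :
    covDeriv G' Y' (θ x) (fderiv ℝ θ x v) = fderiv ℝ θ x (covDeriv G Y x v) := by
  have cθ := hθ.contDiffAt (hG.isOpen.mem_nhds hx)
  have dθ : DifferentiableAt ℝ θ x := cθ.differentiableAt (by simp)
  have ddθ : DifferentiableAt ℝ (fderiv ℝ θ) x :=
    (cθ.fderiv_right (m := ∞) (by simp)).differentiableAt (by simp)
  have h1 := hY'.hasFDerivAt.comp x dθ.hasFDerivAt
  have h2 := ddθ.hasFDerivAt.clm_apply hY.hasFDerivAt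
  have h3 : (Y' ∘ θ) =ᶠ[𝓝 x] fun y ↦ fderiv ℝ θ y (Y y) := by
    filter_upwards [hG.isOpen.mem_nhds hx] with y hy using hYY' y hy
  have h4 := congrArg (fun f : Model d →L[ℝ] Model d ↦ f v)
    (h1.unique (h2.congr_of_eventuallyEq h3))
  simp at h4
  rw [covDeriv, covDeriv, h4, hYY' x hx, map_add,
    fderiv_christoffel_pullback hG hG' hθ hmaps hiso hx hsurj]
  abel

end Covariance

/-! ### Metric and vector fields in charts -/

section Charts

variable {d : ℕ} {M : Type*} [TopologicalSpace M] [ChartedSpace (Model d) M]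
  {φ ψ : OpenPartialHomeomorph M (Model d)} {y : Model d}

namespace IsChart

theorem contMDiffOn (hφ : IsChart φ) : ContMDiffOn (𝓡 d) (𝓡 d) ∞ φ φ.source :=
  contMDiffOn_of_mem_maximalAtlas hφ

theorem contMDiffOn_symm (hφ : IsChart φ) : ContMDiffOn (𝓡 d) (𝓡 d) ∞ φ.symm φ.target :=
  contMDiffOn_symm_of_mem_maximalAtlas hφ

theorem contDiffOn_transition (hφ : IsChart φ) (hψ : IsChart ψ) :
    ContDiffOn ℝ ∞ (ψ ∘ φ.symm) (φ.symm.trans ψ).source := by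
  rw [← contMDiffOn_iff_contDiffOn]
  refine hψ.contMDiffOn.comp (hφ.contMDiffOn_symm.mono fun y hy ↦ ?_) fun y hy ↦ ?_
  · simp at hy
    exact hy.1
  · simp at hy
    exact hy.2

theorem mdifferentiable (hφ : IsChart φ) : φ.MDifferentiable (𝓡 d) (𝓡 d) :=
  ⟨hφ.contMDiffOn.mdifferentiableOn (by simp), hφ.contMDiffOn_symm.mdifferentiableOn (by simp)⟩

theorem mdifferentiableAt_symm (hφ : IsChart φ) (hy : y ∈ φ.target) :
    MDifferentiableAt (𝓡 d) (𝓡 d) φ.symm y := hφ.mdifferentiable.mdifferentiableAt_symm hy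

theorem isInvertible (hφ : IsChart φ) (hy : y ∈ φ.target) :
    (mfderiv (𝓡 d) (𝓡 d) φ.symm y).IsInvertible :=
  ⟨hφ.mdifferentiable.symm.mfderiv (x := y) hy, rfl⟩

end IsChart

theorem mfderiv_fieldInChart {X : (p : M) → TangentSpace (𝓡 d) p} (hφ : IsChart φ) (hy : y ∈ φ.target) :
    mfderiv (𝓡 d) (𝓡 d) φ.symm y (fieldInChart φ X y) = X (φ.symm y) := by
  rw [fieldInChart, VectorField.mpullback_apply]
  exact (hφ.isInvertible hy).self_apply_inverse _

theorem mfderiv_injective (hφ : IsChart φ) (hy : y ∈ φ.target) :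
    Function.Injective (mfderiv (𝓡 d) (𝓡 d) φ.symm y) := (hφ.isInvertible hy).injective

theorem mfderiv_symm_transition (hφ : IsChart φ) (hψ : IsChart ψ)
    (hy : y ∈ (φ.symm.trans ψ).source) (v : Model d) :
    mfderiv (𝓡 d) (𝓡 d) ψ.symm (ψ (φ.symm y)) (fderiv ℝ (ψ ∘ φ.symm) y v)
      = mfderiv (𝓡 d) (𝓡 d) φ.symm y v := by
  have hy' := hy
  simp at hy'
  have h1 : MDifferentiableAt (𝓡 d) (𝓡 d) (ψ ∘ φ.symm) y := by
    rw [mdifferentiableAt_iff_differentiableAt]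
    exact ((hφ.contDiffOn_transition hψ).contDiffAt
      ((φ.symm.trans ψ).open_source.mem_nhds hy)).differentiableAt (by simp)
  have h2 := mfderiv_comp y (hψ.mdifferentiableAt_symm (ψ.map_source hy'.2)) h1
  have h3 : ψ.symm ∘ (ψ ∘ φ.symm) =ᶠ[𝓝 y] φ.symm := by
    filter_upwards [(φ.symm.trans ψ).open_source.mem_nhds hy] with w hw
    simp at hw
    exact ψ.left_inv hw.2
  rw [← mfderiv_eq_fderiv]
  have h4 := congrArg (fun f : Model d →L[ℝ] Model d ↦ f v) (h2.symm.trans h3.mfderiv_eq)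
  exact h4

namespace IsChart

variable [IsManifold (𝓡 d) ∞ M]

/-- The tangent vector with components `N y` at the point with coordinates `y`. -/
theorem contMDiffOn_push (hφ : IsChart φ) {N : Model d → Model d} {U : Set (Model d)}
    (hU : IsOpen U) (hUφ : U ⊆ φ.target) (hN : ContDiffOn ℝ ∞ N U) :
    ContMDiffOn (𝓡 d) (𝓡 d).tangent ∞
      (fun y ↦ (⟨φ.symm y, mfderiv (𝓡 d) (𝓡 d) φ.symm y (N y)⟩ : TangentBundle (𝓡 d) M)) U := by
  have h1 : ContMDiffOn (𝓡 d) (𝓡 d).tangent ∞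
      (fun y ↦ (⟨y, N y⟩ : TangentBundle (𝓡 d) (Model d))) U :=
    contMDiffOn_vectorSpace_iff_contDiffOn.2 hN
  have h2 := (hφ.contMDiffOn_symm.mono hUφ).contMDiffOn_tangentMapWithin (m := ∞) (by simp)
    hU.uniqueMDiffOn
  have h3 := h2.comp h1 (fun y hy ↦ hy)
  refine h3.congr fun y hy ↦ ?_
  simp only [Function.comp, tangentMapWithin]
  rw [mfderivWithin_of_isOpen hU hy]

end IsChart

variable [IsManifold (𝓡 d) ∞ M] (g : LorentzMetric d M)

theorem metricInChart_apply (φ : OpenPartialHomeomorph M (Model d)) (y v w : Model d) :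
    metricInChart g φ y v w = g.inner (φ.symm y) (mfderiv (𝓡 d) (𝓡 d) φ.symm y v)
      (mfderiv (𝓡 d) (𝓡 d) φ.symm y w) := rfl

theorem contDiffOn_metricInChart (hφ : IsChart φ) :
    ContDiffOn ℝ ∞ (metricInChart g φ) φ.target := by
  refine contDiffOn_clm_apply.2 fun v ↦ contDiffOn_clm_apply.2 fun w ↦ ?_
  rw [← contMDiffOn_iff_contDiffOn]
  have h1 : ContMDiffOn (𝓡 d) ((𝓡 d).prod 𝓘(ℝ)) ∞
      (fun y ↦ Bundle.TotalSpace.mk' ℝ (E := Bundle.Trivial M ℝ) (φ.symm y)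
        (g.inner (φ.symm y) (mfderiv (𝓡 d) (𝓡 d) φ.symm y v)
          (mfderiv (𝓡 d) (𝓡 d) φ.symm y w))) φ.target := by
    apply ContMDiffOn.clm_bundle_apply₂ (F₁ := Model d) (F₂ := Model d)
    · exact g.contMDiff.comp_contMDiffOn hφ.contMDiffOn_symm
    · exact hφ.contMDiffOn_push φ.open_target subset_rfl contDiffOn_const
    · exact hφ.contMDiffOn_push φ.open_target subset_rfl contDiffOn_const
  intro y hy
  have h2 := h1 y hy
  simp only [Bundle.contMDiffWithinAt_totalSpace] at h2
  exact h2.2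

theorem LorentzMetric.nondeg (p : M) (v : TangentSpace (𝓡 d) p) (h : ∀ w, g.inner p v w = 0) :
    v = 0 := by
  obtain ⟨b, hb⟩ := g.lorentzian p
  refine b.ext_elem fun j ↦ ?_
  have h1 := h (b j)
  rw [← b.sum_repr v] at h1
  simp only [map_sum, map_smul, sum_apply, smul_apply, hb, smul_eq_mul, mul_ite, mul_zero,
    Finset.sum_ite_eq', Finset.mem_univ, if_true] at h1
  rw [map_zero, Finsupp.zero_apply]
  split_ifs at h1 <;> simpa using h1

theorem isMetricOn_metricInChart (hφ : IsChart φ) :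
    IsMetricOn (metricInChart g φ) φ.target where
  isOpen := φ.open_target
  smooth := contDiffOn_metricInChart g hφ
  symm y _ v w := g.symm _ _ _
  nondeg y hy v h := by
    obtain ⟨e, he⟩ := hφ.isInvertible hy
    have h1 : mfderiv (𝓡 d) (𝓡 d) φ.symm y v = 0 := by
      refine g.nondeg _ _ fun w ↦ ?_
      have h2 := h (e.symm w)
      change g.inner (φ.symm y) (mfderiv (𝓡 d) (𝓡 d) φ.symm y v)
        (mfderiv (𝓡 d) (𝓡 d) φ.symm y (e.symm w)) = 0 at h2
      rw [← he] at h2 ⊢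
      simpa using h2
    rw [← he] at h1
    exact e.injective (h1.trans (map_zero e).symm)

theorem exists_lorentzian_basis (hφ : IsChart φ) (hy : y ∈ φ.target) :
    ∃ b : Module.Basis (Fin d) ℝ (Model d), ∀ i j, metricInChart g φ y (b i) (b j)
      = if i = j then (if (i : ℕ) = 0 then -1 else 1) else 0 := by
  obtain ⟨b, hb⟩ := g.lorentzian (φ.symm y)
  obtain ⟨e, he⟩ := hφ.isInvertible hy
  refine ⟨b.map e.symm.toLinearEquiv, fun i j ↦ ?_⟩
  have h : ∀ k, e (b.map e.symm.toLinearEquiv k) = b k := fun k ↦ by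
    rw [Module.Basis.map_apply]
    exact e.apply_symm_apply _
  rw [metricInChart_apply, ← he, ← hb, ← h i, ← h j]
  rfl

variable {X l : (p : M) → TangentSpace (𝓡 d) p}

theorem contDiffOn_fieldInChart (hφ : IsChart φ) (hX : IsSmoothField X) :
    ContDiffOn ℝ ∞ (fieldInChart φ X) φ.target := by
  refine contMDiffOn_vectorSpace_iff_contDiffOn.1 fun y hy ↦ ?_
  exact (ContMDiffAt.mpullback_vectorField_preimage (n := ∞) (m := ∞) (hX _)
    (hφ.contMDiffOn_symm.contMDiffAt (φ.open_target.mem_nhds hy)) (hφ.isInvertible hy)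
    (by simp)).contMDiffWithinAt

theorem metricInChart_fieldInChart (hφ : IsChart φ) (hy : y ∈ φ.target)
    {X' : (p : M) → TangentSpace (𝓡 d) p} :
    metricInChart g φ y (fieldInChart φ X y) (fieldInChart φ X' y)
      = g.inner (φ.symm y) (X (φ.symm y)) (X' (φ.symm y)) := by
  rw [metricInChart_apply, mfderiv_fieldInChart hφ hy, mfderiv_fieldInChart hφ hy]

/-! ### Change of coordinates -/

end Charts

section Main

variable {d : ℕ} {M : Type*} [TopologicalSpace M] [ChartedSpace (Model d) M]
  [IsManifold (𝓡 d) ∞ M] {φ ψ : OpenPartialHomeomorph M (Model d)} {y : Model d}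
  {g : LorentzMetric d M} {Λ : ℝ} {l : (p : M) → TangentSpace (𝓡 d) p}

theorem IsFrameContaining.isMetricOn {U : Set (Model d)} {F : Frame d}
    (hF : IsFrameContaining g l φ U F) : IsMetricOn (metricInChart g φ) U :=
  (isMetricOn_metricInChart g hF.isChart).mono hF.isOpen hF.subset

theorem IsFrameContaining.nullRotate {U : Set (Model d)} {F : Frame d}
    (hF : IsFrameContaining g l φ U F) {z : Model d → Fin (d - 2) → ℝ}
    (hz : ContDiffOn ℝ ∞ z U) : IsFrameContaining g l φ U (F.nullRotate z) :=
  ⟨hF.isChart, hF.isOpen, hF.subset, hF.isNullFrame.nullRotate hF.isMetricOn hz, hF.l_eq⟩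

/-- In a frame containing the multiple WAND `ℓ`, `τ = 0` implies `τ' = 0`. -/
theorem IsFrameContaining.tau'_eq_zero (hd : 2 ≤ d) (hE : IsEinstein g Λ)
    (hW : IsMultipleWAND g l) (hgeo : IsGeodesic g l) (hdet : HasNondegenerateRho g l)
    {U : Set (Model d)} {F : Frame d} (hF : IsFrameContaining g l φ U F)
    (ht : ∀ x ∈ U, F.tau (metricInChart g φ) x = 0) {x : Model d} (hx : x ∈ U) :
    F.tau' (metricInChart g φ) x = 0 := by
  refine hF.isNullFrame.tau'_eq_zero hF.isMetricOn hd (hgeo φ U F hF) ht (hdet φ U F hF)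
    (fun w hw i ↦ ?_) hx
  rw [← weyl_eq_riemann hF.isNullFrame hw (hE φ hF.isChart w (hF.subset hw))]
  exact (hW.weyl_eq_zero φ U F hF w hw).2.2 i

/-- The null rotation with `z = -ρ⁻¹ τ` achieves `τ = 0`. -/
theorem IsFrameContaining.tau_nullRotate_eq_zero (hd : 2 ≤ d) (hgeo : IsGeodesic g l)
    (hdet : HasNondegenerateRho g l) {U : Set (Model d)} {F : Frame d}
    (hF : IsFrameContaining g l φ U F) {x : Model d} (hx : x ∈ U) :
    (F.nullRotate fun x ↦ -((F.rho (metricInChart g φ) x)⁻¹ *ᵥ F.tau (metricInChart g φ) x)).tau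
      (metricInChart g φ) x = 0 := by
  rw [hF.isNullFrame.tau_nullRotate hF.isMetricOn hd hx (hgeo φ U F hF x hx), Matrix.mulVec_neg,
    Matrix.mulVec_mulVec, Matrix.mul_nonsing_inv _ (isUnit_iff_ne_zero.2 (hdet φ U F hF x hx)),
    Matrix.one_mulVec, add_neg_cancel]

/-- Around every point there is a frame containing `ℓ` with `τ = 0`. -/
theorem exists_frame_tau_eq_zero (hd : 2 ≤ d) (hl : IsNullField g l) (hgeo : IsGeodesic g l)
    (hdet : HasNondegenerateRho g l) (hφ : IsChart φ) (hy : y ∈ φ.target) :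
    ∃ U F, y ∈ U ∧ IsFrameContaining g l φ U F ∧
      ∀ x ∈ U, F.tau (metricInChart g φ) x = 0 := by
  have h0 : fieldInChart φ l y ≠ 0 := fun h ↦ hl.ne_zero (φ.symm y) (by
    rw [← mfderiv_fieldInChart (X := l) hφ hy, h]
    exact map_zero (mfderiv (𝓡 d) (𝓡 d) φ.symm y))
  obtain ⟨U, hU, hUφ, hyU, F, hF, hFl⟩ := exists_isNullFrame hd (isMetricOn_metricInChart g hφ) hy
    (exists_lorentzian_basis g hφ hy) (contDiffOn_fieldInChart hφ hl.smooth)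
    (fun x hx ↦ by rw [metricInChart_fieldInChart g hφ hx, hl.null]) h0
  have hFc : IsFrameContaining g l φ U F := ⟨hφ, hU, hUφ, hF, fun x _ ↦ by rw [hFl]⟩
  exact ⟨U, _, hyU, hFc.nullRotate (hF.contDiffOn_rho_inv_tau hFc.isMetricOn (hdet φ U F hFc)),
    fun x hx ↦ hFc.tau_nullRotate_eq_zero hd hgeo hdet hx⟩

/-- `v` is null with `ℓ·v = 1` and `∇_v ℓ ∝ ℓ` at `y`. -/
def IsAligned (G : Metric d) (L : Model d → Model d) (y v : Model d) : Prop :=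
  G y v v = 0 ∧ G y (L y) v = 1 ∧ ∃ c : ℝ, covDeriv G L y v = c • L y

namespace IsFrameContaining

variable {U : Set (Model d)} {F : Frame d} (hF : IsFrameContaining g l φ U F) {x : Model d}
include hF

theorem covDeriv_l (hx : x ∈ U) (v : Model d) :
    covDeriv (metricInChart g φ) F.l x v
      = covDeriv (metricInChart g φ) (fieldInChart φ l) x v :=
  covDeriv_congr _ (by filter_upwards [hF.isOpen.mem_nhds hx] with w hw using hF.l_eq w hw) v

theorem isAligned_n (hd : 2 ≤ d) (hx : x ∈ U) (ht : F.tau (metricInChart g φ) x = 0) :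
    IsAligned (metricInChart g φ) (fieldInChart φ l) x (F.n x) := by
  obtain ⟨c, hc⟩ := hF.isNullFrame.covDeriv_n_l hF.isMetricOn hd hx ht
  rw [hF.covDeriv_l hx, hF.l_eq x hx] at hc
  exact ⟨hF.isNullFrame.nn x hx, by rw [← hF.l_eq x hx, hF.isNullFrame.ln x hx], c, hc⟩

theorem eq_n_of_isAligned (hd : 2 ≤ d) (hgeo : IsGeodesic g l) (hdet : HasNondegenerateRho g l)
    (hx : x ∈ U) (ht : F.tau (metricInChart g φ) x = 0) {v : Model d}
    (hv : IsAligned (metricInChart g φ) (fieldInChart φ l) x v) : v = F.n x := by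
  obtain ⟨h1, h2, c, hc⟩ := hv
  rw [← hF.covDeriv_l hx, ← hF.l_eq x hx] at hc
  rw [← hF.l_eq x hx] at h2
  exact hF.isNullFrame.eq_n hF.isMetricOn hd hx (hgeo φ U F hF x hx) ht (hdet φ U F hF x hx)
    h1 h2 hc

theorem tau_eq_zero_of_isAligned (hx : x ∈ U)
    (hn : IsAligned (metricInChart g φ) (fieldInChart φ l) x (F.n x)) :
    F.tau (metricInChart g φ) x = 0 := by
  obtain ⟨-, -, c, hc⟩ := hn
  rw [← hF.covDeriv_l hx, ← hF.l_eq x hx] at hc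
  exact hF.isNullFrame.tau_eq_zero_of_covDeriv hF.isMetricOn hx hc

end IsFrameContaining

/-- Alignment does not depend on the coordinates. -/
theorem IsAligned.transition (hl : IsSmoothField l) (hφ : IsChart φ) (hψ : IsChart ψ)
    (hy : y ∈ (φ.symm.trans ψ).source) {v : Model d}
    (hv : IsAligned (metricInChart g φ) (fieldInChart φ l) y v) :
    IsAligned (metricInChart g ψ) (fieldInChart ψ l) (ψ (φ.symm y))
      (fderiv ℝ (ψ ∘ φ.symm) y v) := by
  have hsub : (φ.symm.trans ψ).source ⊆ φ.target := fun w hw ↦ by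
    simp at hw
    exact hw.1
  have hmaps : Set.MapsTo (ψ ∘ φ.symm) (φ.symm.trans ψ).source ψ.target := fun w hw ↦ by
    simp at hw
    exact ψ.map_source hw.2
  have hiso : ∀ w ∈ (φ.symm.trans ψ).source, ∀ u u', metricInChart g φ w u u'
      = metricInChart g ψ ((ψ ∘ φ.symm) w) (fderiv ℝ (ψ ∘ φ.symm) w u)
        (fderiv ℝ (ψ ∘ φ.symm) w u') := fun w hw u u' ↦ by
    rw [metricInChart_apply, metricInChart_apply, Function.comp_apply]
    have hw' := hw
    simp at hw'
    have h1 : ψ.symm (ψ (φ.symm w)) = φ.symm w := ψ.left_inv hw'.2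
    rw [mfderiv_symm_transition hφ hψ hw, mfderiv_symm_transition hφ hψ hw, h1]
  have hfield : ∀ w ∈ (φ.symm.trans ψ).source, fieldInChart ψ l ((ψ ∘ φ.symm) w)
      = fderiv ℝ (ψ ∘ φ.symm) w (fieldInChart φ l w) := fun w hw ↦ by
    have hw' := hw
    simp at hw'
    refine mfderiv_injective hψ (hmaps hw) ?_
    rw [mfderiv_fieldInChart hψ (hmaps hw), Function.comp_apply,
      mfderiv_symm_transition hφ hψ hw, mfderiv_fieldInChart hφ hw'.1, ψ.left_inv hw'.2]
  have hsurj : Function.Surjective (fderiv ℝ (ψ ∘ φ.symm) y) := by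
    refine (LinearMap.injective_iff_surjective
      (f := (fderiv ℝ (ψ ∘ φ.symm) y).toLinearMap)).1 fun u u' h ↦ mfderiv_injective hφ (hsub hy) ?_
    rw [← mfderiv_symm_transition hφ hψ hy, ← mfderiv_symm_transition hφ hψ hy]
    exact congrArg _ h
  have hGφ := (isMetricOn_metricInChart g hφ).mono (φ.symm.trans ψ).open_source hsub
  have hGψ := isMetricOn_metricInChart g hψ
  have dl : ∀ {χ : OpenPartialHomeomorph M (Model d)}, IsChart χ → ∀ {w}, w ∈ χ.target →
      DifferentiableAt ℝ (fieldInChart χ l) w := fun {χ} hχ {w} hw ↦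
    ((contDiffOn_fieldInChart hχ hl).contDiffAt (χ.open_target.mem_nhds hw)).differentiableAt
      (by simp)
  have hcov := fderiv_covDeriv_pullback hGφ hGψ (hφ.contDiffOn_transition hψ) hmaps hiso hy hsurj
    (dl hφ (hsub hy)) (dl hψ (hmaps hy)) hfield v
  obtain ⟨h1, h2, c, hc⟩ := hv
  refine ⟨(hiso y hy v v).symm.trans h1, ?_, c, ?_⟩
  · have := hfield y hy
    rw [Function.comp_apply] at this
    rw [this]
    exact (hiso y hy _ v).symm.trans h2
  · have := hfield y hy
    rw [Function.comp_apply] at this hcov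
    rw [hcov, hc, map_smul, this]

/-- There is a vector field on the spacetime which is aligned in all charts. -/
theorem exists_aligned_field (hd : 2 ≤ d) (hl : IsNullField g l) (hgeo : IsGeodesic g l)
    (hdet : HasNondegenerateRho g l) :
    ∃ n : (p : M) → TangentSpace (𝓡 d) p, ∀ φ, IsChart φ → ∀ y ∈ φ.target,
      IsAligned (metricInChart g φ) (fieldInChart φ l) y (fieldInChart φ n y) := by
  have hchart : ∀ p : M, IsChart (chartAt (Model d) p) := fun p ↦
    IsManifold.chart_mem_maximalAtlas p
  have hex : ∀ p : M, ∃ v, IsAligned (metricInChart g (chartAt (Model d) p))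
      (fieldInChart (chartAt (Model d) p) l) (chartAt (Model d) p p) v := fun p ↦ by
    obtain ⟨U, F, hU, hF, ht⟩ := exists_frame_tau_eq_zero hd hl hgeo hdet (hchart p)
      (mem_chart_target (Model d) p)
    exact ⟨_, hF.isAligned_n hd hU (ht _ hU)⟩
  choose v hv using hex
  refine ⟨fun p ↦ (mfderiv (𝓡 d) (𝓡 d) (chartAt (Model d) p).symm (chartAt (Model d) p p) (v p) :),
    fun φ hφ y hy ↦ ?_⟩
  set p := φ.symm y with hp
  set χ := chartAt (Model d) p with hχ
  have hpχ : χ.symm (χ p) = p := χ.left_inv (mem_chart_source _ p)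
  have hs : χ p ∈ (χ.symm.trans φ).source := by
    simp only [OpenPartialHomeomorph.trans_source, OpenPartialHomeomorph.symm_source,
      Set.mem_inter_iff, Set.mem_preimage]
    rw [hpχ]
    exact ⟨mem_chart_target _ p, φ.map_target hy⟩
  have hyp : φ (χ.symm (χ p)) = y := by rw [hpχ, hp, φ.right_inv hy]
  have h1 := (hv p).transition hl.smooth (hchart p) hφ hs
  have h2 := mfderiv_symm_transition (hchart p) hφ hs (v p)
  rw [← hχ] at h1 h2
  rw [hyp] at h1 h2
  convert h1 using 1
  refine mfderiv_injective hφ hy ?_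
  exact (mfderiv_fieldInChart hφ hy).trans h2.symm

/-- An aligned vector field is smooth. -/
theorem isSmoothField_of_isAligned (hd : 2 ≤ d) (hl : IsNullField g l) (hgeo : IsGeodesic g l)
    (hdet : HasNondegenerateRho g l) {n : (p : M) → TangentSpace (𝓡 d) p}
    (hn : ∀ φ, IsChart φ → ∀ y ∈ φ.target,
      IsAligned (metricInChart g φ) (fieldInChart φ l) y (fieldInChart φ n y)) :
    IsSmoothField n := by
  intro p
  set χ := chartAt (Model d) p
  have hχ : IsChart χ := IsManifold.chart_mem_maximalAtlas p
  have hsm : ContDiffOn ℝ ∞ (fieldInChart χ n) χ.target := by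
    intro y hy
    obtain ⟨U, F, hyU, hF, ht⟩ := exists_frame_tau_eq_zero hd hl hgeo hdet hχ hy
    have h1 : fieldInChart χ n =ᶠ[𝓝 y] F.n := by
      filter_upwards [hF.isOpen.mem_nhds hyU] with w hw
      exact hF.eq_n_of_isAligned hd hgeo hdet hw (ht w hw) (hn χ hχ w (hF.subset hw))
    exact ((hF.isNullFrame.contDiffAt_n hF.isMetricOn hyU).congr_of_eventuallyEq
      h1).contDiffWithinAt
  have h2 := (hχ.contMDiffOn_push χ.open_target subset_rfl hsm).comp hχ.contMDiffOn
    (fun q hq ↦ χ.map_source hq)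
  have h3 : ContMDiffOn (𝓡 d) (𝓡 d).tangent ∞ (fun p ↦ (⟨p, n p⟩ : TangentBundle (𝓡 d) M))
      χ.source := by
    refine h2.congr fun q hq ↦ ?_
    simp only [Function.comp_apply]
    rw [mfderiv_fieldInChart hχ (χ.map_source hq), χ.left_inv hq]
  exact h3.contMDiffAt (χ.open_source.mem_nhds (mem_chart_source _ p))

end Main

end GHP

end

open GHP
theorem mainTheorem3 (d : ℕ) (hd : 4 ≤ d) {M : Type*} [TopologicalSpace M]
    [ChartedSpace (Model d) M] [IsManifold (𝓡 d) ∞ M]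
    (g : LorentzMetric d M) (Λ : ℝ) (hE : IsEinstein g Λ)
    (l : (p : M) → TangentSpace (𝓡 d) p)
    (hW : IsMultipleWAND g l) (hgeo : IsGeodesic g l) (hdet : HasNondegenerateRho g l) :
    -- in any null frame containing `ℓ`, the null rotation about `ℓ` with `z = -ρ⁻¹ τ`
    -- achieves `τ = τ' = 0`, and `þ z = -τ'`
    (∀ φ U F, IsFrameContaining g l φ U F →
      ∀ z : Model d → Fin (d - 2) → ℝ,
        (z = fun x ↦ -((F.rho (metricInChart g φ) x)⁻¹ *ᵥ F.tau (metricInChart g φ) x)) →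
        ContDiffOn ℝ ∞ z U ∧
        IsFrameContaining g l φ U (F.nullRotate z) ∧
        (∀ x ∈ U, (F.nullRotate z).tau (metricInChart g φ) x = 0) ∧
        (∀ x ∈ U, (F.nullRotate z).tau' (metricInChart g φ) x = 0) ∧
        (∀ x ∈ U, F.thorn (metricInChart g φ) (-1) z x = -F.tau' (metricInChart g φ) x)) ∧
    -- hence there is a second null vector field `n` on the spacetime with `τ = τ' = 0`
    (∃ n : (p : M) → TangentSpace (𝓡 d) p, IsNullField g n ∧
      (∀ p, g.inner p (l p) (n p) = 1) ∧
      (∀ φ, IsChart φ → ∀ y ∈ φ.target, ∃ U F, y ∈ U ∧ IsFrameContainingPair g l n φ U F) ∧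
      (∀ φ U F, IsFrameContainingPair g l n φ U F → ∀ x ∈ U,
        F.tau (metricInChart g φ) x = 0 ∧ F.tau' (metricInChart g φ) x = 0)) := by
  have hd2 : 2 ≤ d := by omega
  refine ⟨fun φ U F hF z hz ↦ ?_, ?_⟩
  · have hsm : ContDiffOn ℝ ∞ z U := by
      rw [hz]
      exact hF.isNullFrame.contDiffOn_rho_inv_tau hF.isMetricOn (hdet φ U F hF)
    have hτ : ∀ x ∈ U, (F.nullRotate z).tau (metricInChart g φ) x = 0 := fun x hx ↦ by
      rw [hz]
      exact hF.tau_nullRotate_eq_zero hd2 hgeo hdet hx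
    have hτ' : ∀ x ∈ U, (F.nullRotate z).tau' (metricInChart g φ) x = 0 := fun x hx ↦
      (hF.nullRotate hsm).tau'_eq_zero hd2 hE hW hgeo hdet hτ hx
    refine ⟨hsm, hF.nullRotate hsm, hτ, hτ', fun x hx ↦ ?_⟩
    have h := hF.isNullFrame.tau'_nullRotate hF.isMetricOn hsm hx (hgeo φ U F hF x hx)
    rw [hτ' x hx] at h
    exact eq_neg_of_add_eq_zero_right h.symm
  · obtain ⟨n, hn⟩ := exists_aligned_field hd2 hW.isNullField hgeo hdet
    have hchart : ∀ p : M, IsChart (chartAt (Model d) p) := fun p ↦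
      IsManifold.chart_mem_maximalAtlas p
    have hpt : ∀ p : M, g.inner p (n p) (n p) = 0 ∧ g.inner p (l p) (n p) = 1 := fun p ↦ by
      have hp := mem_chart_target (Model d) p
      obtain ⟨h1, h2, -⟩ := hn _ (hchart p) _ hp
      rw [metricInChart_fieldInChart g (hchart p) hp,
        (chartAt (Model d) p).left_inv (mem_chart_source _ p)] at h1 h2
      exact ⟨h1, h2⟩
    refine ⟨n, ⟨isSmoothField_of_isAligned hd2 hW.isNullField hgeo hdet hn, fun p h0 ↦ ?_,
      fun p ↦ (hpt p).1⟩, fun p ↦ (hpt p).2, fun φ hφ y hy ↦ ?_, fun φ U F hF x hx ↦ ?_⟩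
    · have := (hpt p).2
      rw [h0, map_zero] at this
      exact zero_ne_one this
    · obtain ⟨U, F, hyU, hF, ht⟩ :=
        exists_frame_tau_eq_zero hd2 hW.isNullField hgeo hdet hφ hy
      exact ⟨U, F, hyU, hF, fun x hx ↦ (hF.eq_n_of_isAligned hd2 hgeo hdet hx (ht x hx)
        (hn φ hφ x (hF.subset hx))).symm⟩
    · have ht : ∀ w ∈ U, F.tau (metricInChart g φ) w = 0 := fun w hw ↦
        hF.1.tau_eq_zero_of_isAligned hw (by
          rw [hF.2 w hw]
          exact hn φ hF.1.isChart w (hF.1.subset hw))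
      exact ⟨ht x hx, hF.1.tau'_eq_zero hd2 hE hW hgeo hdet ht hx⟩
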